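/- Let $m \ge 1$ be a fixed integer and let $U_1, U_2, \dots$ be an infinite sequence of i.i.d. random variables, uniform on $[0,1]$. For $n \ge 1$ put $k = mn$, let $U_{(1)} \le \dots \le U_{(k-1)}$ be the order statistics of $U_1, \dots, U_{k-1}$ (for this $k$), set $U_{(0)} = 0$, $U_{(k)} = 1$, and define the maximal non-overlapping $m$-spacing $$M^{(\mathrm{no})}_{k,m} = \max_{1 \le i \le n} \bigl(U_{(im)} - U_{((i-1)m)}\bigr).$$ Let $G(x) = \exp(-\exp(-x))$ be the standard Gumbel distribution function and, for $n \ge 2$, let $f_n = (m-1)\log\log n - \log((m-1)!)$. Then: 1. For every real $x$, $\displaystyle \Pr\bigl\{ M^{(\mathrm{no})}_{k,m}\cdot mn - \log n - f_n < x \bigr\} \to G(x)$ as $n \to \infty$. 2. There is a constant $C$ depending only on $m$ such that, almost surely, for all sufficiently large $n$ (how large may depend on the outcome), $$M^{(\mathrm{no})}_{k,m} \le \frac{\log n}{mn} + C\,\frac{\log\log n}{n}.$$ 3. Almost surely, $\displaystyle \frac{M^{(\mathrm{no})}_{k,m}\cdot mn}{\log n} \to 1$ as $n \to \infty$. -/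

import Mathlib

namespace UniformSpacings

open MeasureTheory ProbabilityTheory

/-- The order statistics `u_(0), …, u_(N+1)` of the first `N` terms `u 0, …, u (N - 1)` of a
sequence of points of the unit interval, with the conventions `u_(0) = 0` and `u_(N+1) = 1`.
For `1 ≤ i ≤ N`, `orderStat N u i` is the `i`-th smallest of these `N` terms
(counted with multiplicity). -/
noncomputable def orderStat (N : ℕ) (u : ℕ → ℝ) (i : ℕ) : ℝ :=
  if i = 0 then 0
  else if h : i - 1 < N then
    ((fun j : Fin N => u j) ∘ Tuple.sort (fun j : Fin N => u j)) ⟨i - 1, h⟩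
  else 1

/-- The `i`-th (`1 ≤ i ≤ k`) of the `k` spacings `S_i = u_(i) - u_(i-1)` into which
the first `k - 1` terms of `u` divide the unit interval. -/
noncomputable def spacing (k : ℕ) (u : ℕ → ℝ) (i : ℕ) : ℝ :=
  orderStat (k - 1) u i - orderStat (k - 1) u (i - 1)

/-- The maximal non-overlapping `m`-spacing of the `k = m * n` spacings determined by the first
`k - 1` terms of `u`: the maximum over `i = 1, …, n` of `u_(i m) - u_((i-1) m)`.
The index `i : Fin n` below runs from `0`. -/
noncomputable def maxNonoverlapping (m n : ℕ) (u : ℕ → ℝ) : ℝ :=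
  ⨆ i : Fin n,
    (orderStat (m * n - 1) u ((i + 1) * m) - orderStat (m * n - 1) u (i * m))

/-- A block difference of order statistics is the sum of the spacings in the block. -/
theorem sum_spacing_block (k m i : ℕ) (u : ℕ → ℝ) :
    ∑ j ∈ Finset.range m, spacing k u (i * m + j + 1) =
      orderStat (k - 1) u ((i + 1) * m) - orderStat (k - 1) u (i * m) := by
  have h := Finset.sum_range_sub (fun j => orderStat (k - 1) u (i * m + j)) m
  simpa [spacing, add_assoc, Nat.succ_mul] using h

/-- `U 0, U 1, …` are independent real random variables, each uniform on `[0, 1]`. -/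
structure IsIIDUniform {Ω : Type*} [MeasurableSpace Ω] (P : Measure Ω) (U : ℕ → Ω → ℝ) :
    Prop where
  measurable : ∀ i, Measurable (U i)
  indep : iIndepFun U P
  uniform : ∀ i, pdf.IsUniform (U i) (Set.Icc 0 1) P volume

/-- The centering sequence `f_n = (m - 1) log log n - log ((m - 1)!)` (used for `m ≥ 1`). -/
noncomputable def centering (m n : ℕ) : ℝ :=
  ((m : ℝ) - 1) * Real.log (Real.log n) - Real.log ((m - 1).factorial : ℝ)

/-- The standard Gumbel distribution function `G(x) = exp (-exp (-x))`. -/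
noncomputable def gumbel (x : ℝ) : ℝ := Real.exp (-Real.exp (-x))

end UniformSpacings

/-!
The `k` spacings of `k - 1` uniform points are distributed as `k` independent standard exponential
variables divided by their total, and the total is independent of the spacings
(`IsIIDUniform.measure_mul_expPi`). Both facts come from one computation: the partial sums of the
exponential variables have density `exp (-s)` (with `s` the total) on the cone of increasing tuples,
so rescaling by `s` leaves Lebesgue measure on the increasing tuples of the unit cube and the weight
`s ^ (k - 1) * exp (-s)` for the total (`expPi_partialSums`); the cube itself splits into `(k - 1)!`
congruent chambers according to the ordering of the coordinates (`volume_sorted_mem`).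

Restricting to the event that the total lies within `c` of its mean `k`, which has probability at
least `1 - k / c ^ 2`, turns events about a maximal spacing into events about independent Gamma
variables (`IsIIDUniform.measureReal_mul_le`). For the `n` disjoint blocks the latter have
probability `(1 - gammaTail m y) ^ n`, with the explicit tail
`gammaTail m y = exp (-y) * ∑ j < m, y ^ j / j!`. With `c = k / (log n) ^ 2` the two sides of the
resulting sandwich both have argument `log n + f_n + x + o(1)`, and
`n * gammaTail m (log n + f_n + x + o(1))` tends to `exp (-x)`; this is the Gumbel limit. The same
inequality at `(1 - ε) * log n` gives a summable bound, hence the almost sure lower bound.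

The upper bound cannot be summed over all `n`, and the maximum over disjoint blocks is not monotone
in `n`. It is replaced by a monotone event: some subinterval of `[0, 1]` of length `t` has fewer than
`m` points in its interior (`HasSparseInterval`). A union bound over all windows of `m` consecutive
spacings controls this event, Borel–Cantelli applies along `n ≈ exp √j`, and consecutive terms of
this sequence are close enough to cover all `n` at the cost of a term of order `log log n / n`.
-/

namespace UniformSpacings

open MeasureTheory ProbabilityTheory Set
open scoped ENNReal

/-! ### Exponential variables and their partial sums -/

/-- Tonelli's theorem for a product of functions of one coordinate each. -/
theorem lintegral_fin_prod_pi {k : ℕ} (μ : Fin k → Measure ℝ) [∀ i, SigmaFinite (μ i)]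
    (f : Fin k → ℝ → ℝ≥0∞) (hf : ∀ i, Measurable (f i)) :
    ∫⁻ x, ∏ i, f i (x i) ∂(Measure.pi μ) = ∏ i, ∫⁻ t, f i t ∂(μ i) := by
  induction k with
  | zero => simp
  | succ k ih =>
    rw [← ((measurePreserving_piFinSuccAbove μ 0).symm).lintegral_comp_emb
      (MeasurableEquiv.measurableEmbedding _)]
    simp_rw [Fin.prod_univ_succ]
    rw [← ih (fun i => μ (Fin.succ i)) (fun i => f (Fin.succ i)) (fun i => hf _),
      ← lintegral_prod_mul (hf 0).aemeasurable]
    · simp [MeasurableEquiv.piFinSuccAbove]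
    · exact (Finset.measurable_prod _ fun i _ => (hf _).comp (measurable_pi_apply i)).aemeasurable

theorem pi_withDensity_volume {k : ℕ} (f : ℝ → ℝ≥0∞) (hf : Measurable f)
    [SigmaFinite ((volume : Measure ℝ).withDensity f)] :
    Measure.pi (fun _ : Fin k => (volume : Measure ℝ).withDensity f) =
      (volume : Measure (Fin k → ℝ)).withDensity (fun x => ∏ i, f (x i)) := by
  refine Measure.pi_eq fun s hs => ?_
  rw [withDensity_apply _ (MeasurableSet.univ_pi hs), volume_pi, Measure.restrict_pi_pi,
    lintegral_fin_prod_pi _ _ fun _ => hf]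
  exact Finset.prod_congr rfl fun i _ => (withDensity_apply _ (hs i)).symm

/-- The law of `k` independent standard exponential variables. -/
noncomputable def expPi (k : ℕ) : Measure (Fin k → ℝ) := Measure.pi fun _ => expMeasure 1

instance instIsProbabilityMeasureExpMeasureOne : IsProbabilityMeasure (expMeasure 1) :=
  isProbabilityMeasure_expMeasure one_pos

instance instIsProbabilityMeasureExpPi (k : ℕ) : IsProbabilityMeasure (expPi k) := by
  unfold expPi; infer_instance

theorem expPi_eq_withDensity (k : ℕ) :
    expPi k = (volume : Measure (Fin k → ℝ)).withDensity
      (fun x => if ∀ i, 0 ≤ x i then ENNReal.ofReal (Real.exp (-∑ i, x i)) else 0) := by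
  have h : expMeasure 1 = (volume : Measure ℝ).withDensity (exponentialPDF 1) := rfl
  have hm : Measurable (exponentialPDF 1) :=
    (measurable_exponentialPDFReal 1).ennreal_ofReal
  have : SigmaFinite ((volume : Measure ℝ).withDensity (exponentialPDF 1)) := by
    rw [← h]; infer_instance
  unfold expPi
  rw [h, pi_withDensity_volume _ hm]
  congr 1
  ext x
  split_ifs with hx
  · rw [← Finset.sum_neg_distrib, Real.exp_sum, ENNReal.ofReal_prod_of_nonneg
      fun i _ => (Real.exp_pos _).le]
    refine Finset.prod_congr rfl fun i _ => ?_
    rw [exponentialPDF_of_nonneg (hx i)]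
    simp
  · push Not at hx
    obtain ⟨i, hi⟩ := hx
    exact Finset.prod_eq_zero (Finset.mem_univ i) (exponentialPDF_of_neg hi)

/-- The map sending `x` to the pair of its total and its proper partial sums `x 0 + ⋯ + x i`,
`i < N`. -/
def partialSums (N : ℕ) (x : Fin (N + 1) → ℝ) : ℝ × (Fin N → ℝ) :=
  (∑ j, x j, fun i => ∑ j ∈ Finset.Iic i.castSucc, x j)

/-- The partial sum map is linear with a unitriangular matrix. -/
theorem measurePreserving_partialSums (N : ℕ) :
    MeasurePreserving (partialSums N) volume volume := by
  let A : Matrix (Fin (N + 1)) (Fin (N + 1)) ℝ := fun i j => if j ≤ i then 1 else 0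
  have hdet : A.det = 1 := by
    rw [Matrix.det_of_isLowerTriangular]
    · simp [A]
    · intro i j hij
      simp only [A, ite_eq_right_iff, one_ne_zero, imp_false, not_le]
      exact hij
  have h1 : MeasurePreserving (Matrix.toLin' A) volume volume := by
    refine ⟨(LinearMap.continuous_on_pi _).measurable, ?_⟩
    rw [Real.map_matrix_volume_pi_eq_smul_volume_pi (by rw [hdet]; exact one_ne_zero), hdet]
    simp
  have h2 := (volume_preserving_piFinSuccAbove (fun _ : Fin (N + 1) => ℝ) (Fin.last N)).comp h1
  have h3 : partialSums N = MeasurableEquiv.piFinSuccAbove (fun _ : Fin (N + 1) => ℝ) (Fin.last N) ∘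
      Matrix.toLin' A := ?_
  · rw [h3]; exact h2
  have hA : ∀ x i, Matrix.toLin' A x i = ∑ j ∈ Finset.Iic i, x j := by
    intro x i
    rw [Matrix.toLin'_apply]
    simp [A, Matrix.mulVec, dotProduct, ← Finset.sum_filter, Finset.filter_ge_eq_Iic]
  funext x
  refine Prod.ext ?_ (funext fun i => ?_)
  · change _ = Matrix.toLin' A x (Fin.last N)
    rw [hA, show Finset.Iic (Fin.last N) = Finset.univ from by ext; simp [Fin.le_last]]
    rfl
  · change _ = Matrix.toLin' A x ((Fin.last N).succAbove i)
    rw [hA, Fin.succAbove_last]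
    rfl

/-- Nonnegativity of increments, expressed through the partial sums. -/
theorem forall_nonneg_iff_partialSums {N : ℕ} (x : Fin (N + 1) → ℝ) :
    (∀ i, 0 ≤ x i) ↔ Monotone (partialSums N x).2 ∧
      (∀ i, 0 ≤ (partialSums N x).2 i ∧ (partialSums N x).2 i ≤ (partialSums N x).1) ∧
      0 ≤ (partialSums N x).1 := by
  constructor
  · intro h
    refine ⟨fun i j hij => ?_, fun i => ⟨?_, ?_⟩, ?_⟩
    · exact Finset.sum_le_sum_of_subset_of_nonneg
        (Finset.Iic_subset_Iic.2 (Fin.castSucc_le_castSucc_iff.2 hij)) fun _ _ _ => h _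
    · exact Finset.sum_nonneg (s := Finset.Iic i.castSucc) (f := x) fun _ _ => h _
    · exact Finset.sum_le_sum_of_subset_of_nonneg (s := Finset.Iic i.castSucc) (f := x)
        (Finset.subset_univ _) fun _ _ _ => h _
    · exact Finset.sum_nonneg (s := Finset.univ) (f := x) fun _ _ => h _
  · rintro ⟨hmono, hb, h0⟩
    -- each `x i` is a difference of consecutive partial sums, the last of which is the total
    have hI : ∀ i : Fin N, ∑ j ∈ Finset.Iic i.castSucc, x j = (partialSums N x).2 i := fun _ => rfl
    have hT : ∑ j ∈ Finset.Iic (Fin.last N), x j = (partialSums N x).1 := by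
      rw [show Finset.Iic (Fin.last N) = Finset.univ from by ext; simp [Fin.le_last]]; rfl
    have hstep : ∀ i : Fin N, ∑ j ∈ Finset.Iic i.succ, x j =
        ∑ j ∈ Finset.Iic i.castSucc, x j + x i.succ := by
      intro i
      have : Finset.Iic i.succ = insert i.succ (Finset.Iic i.castSucc) := by
        ext j
        simp only [Finset.mem_Iic, Finset.mem_insert, Fin.le_def, Fin.ext_iff, Fin.val_succ,
          Fin.val_castSucc]
        omega
      rw [this, Finset.sum_insert (by simp [Fin.le_def]), add_comm]
    have hzero : ∑ j ∈ Finset.Iic (0 : Fin (N + 1)), x j = x 0 := by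
      rw [show Finset.Iic (0 : Fin (N + 1)) = {0} from by ext j; simp]; simp
    intro i
    induction i using Fin.cases with
    | zero =>
      rw [← hzero]
      rcases Nat.eq_zero_or_pos N with rfl | hN
      · have := hT
        simp only [Fin.last_zero] at this
        rw [show (0 : Fin (0 + 1)) = 0 from rfl, this]
        exact h0
      · have := hI ⟨0, hN⟩
        rw [show (0 : Fin (N + 1)) = (⟨0, hN⟩ : Fin N).castSucc from rfl, this]
        exact (hb _).1
    | succ i =>
      have hs := hstep i
      rw [hI] at hs
      by_cases hi : (i : ℕ) + 1 < N
      · have := hI ⟨i + 1, hi⟩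
        rw [show (⟨i + 1, hi⟩ : Fin N).castSucc = i.succ from rfl] at this
        have hle : (partialSums N x).2 i ≤ (partialSums N x).2 ⟨i + 1, hi⟩ :=
          hmono (by simp [Fin.le_def])
        linarith
      · have : i.succ = Fin.last N := by ext; simp; omega
        rw [this, hT] at hs
        rw [this]
        linarith [(hb i).2]

/-- The increasing tuples of points of the unit interval that belong to `D`. -/
def sortedPart {N : ℕ} (D : Set (Fin N → ℝ)) : Set (Fin N → ℝ) :=
  {y | y ∈ D ∧ Monotone y ∧ ∀ i, y i ∈ Icc (0 : ℝ) 1}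

theorem measurableSet_monotone (N : ℕ) : MeasurableSet {y : Fin N → ℝ | Monotone y} := by
  simp only [Monotone, ofPred_forall]
  exact MeasurableSet.iInter fun i => MeasurableSet.iInter fun j => MeasurableSet.iInter fun _ =>
    measurableSet_le (measurable_pi_apply i) (measurable_pi_apply j)

theorem measurableSet_sortedPart {N : ℕ} {D : Set (Fin N → ℝ)} (hD : MeasurableSet D) :
    MeasurableSet (sortedPart D) := by
  refine hD.inter ((measurableSet_monotone N).inter ?_)
  have : {y : Fin N → ℝ | ∀ i, y i ∈ Icc (0 : ℝ) 1} = univ.pi fun _ => Icc 0 1 := by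
    ext; simp only [mem_ofPred_eq, mem_univ_pi]
  change MeasurableSet {y : Fin N → ℝ | ∀ i, y i ∈ Icc (0 : ℝ) 1}
  rw [this]
  exact MeasurableSet.univ_pi fun _ => measurableSet_Icc

/-- Rescaling by the total turns the partial sums of exponential variables into an increasing tuple
of the unit interval, uniformly distributed and independent of the total, whose density is
proportional to `s ^ N * exp (-s)`. -/
theorem expPi_partialSums (N : ℕ) {D : Set (Fin N → ℝ)} (hD : MeasurableSet D) {J : Set ℝ}
    (hJ : MeasurableSet J) :
    expPi (N + 1) {x | (partialSums N x).1 ∈ J ∧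
        (partialSums N x).1⁻¹ • (partialSums N x).2 ∈ D} =
      (∫⁻ s in J ∩ Ioi 0, ENNReal.ofReal (Real.exp (-s) * s ^ N)) * volume (sortedPart D) := by
  classical
  have hΨ := measurePreserving_partialSums N
  let S : Set (ℝ × (Fin N → ℝ)) := {p | (Monotone p.2 ∧ (∀ i, 0 ≤ p.2 i ∧ p.2 i ≤ p.1) ∧ 0 ≤ p.1) ∧
    p.1 ∈ J ∧ p.1⁻¹ • p.2 ∈ D}
  have hS : MeasurableSet S := by
    refine MeasurableSet.inter (MeasurableSet.inter ?_ (MeasurableSet.inter ?_ ?_))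
      (MeasurableSet.inter ?_ ?_)
    · exact measurable_snd (measurableSet_monotone N)
    · have : {p : ℝ × (Fin N → ℝ) | ∀ i, 0 ≤ p.2 i ∧ p.2 i ≤ p.1} =
          ⋂ i, {p | 0 ≤ p.2 i ∧ p.2 i ≤ p.1} := by ext; simp
      change MeasurableSet {p : ℝ × (Fin N → ℝ) | ∀ i, 0 ≤ p.2 i ∧ p.2 i ≤ p.1}
      rw [this]
      refine MeasurableSet.iInter fun i => MeasurableSet.inter ?_ ?_
      · exact measurableSet_le measurable_const ((measurable_pi_apply i).comp measurable_snd)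
      · exact measurableSet_le ((measurable_pi_apply i).comp measurable_snd) measurable_fst
    · exact measurableSet_le measurable_const measurable_fst
    · exact measurable_fst hJ
    · exact (measurable_fst.inv.smul measurable_snd) hD
  let G : ℝ × (Fin N → ℝ) → ℝ≥0∞ := S.indicator fun p => ENNReal.ofReal (Real.exp (-p.1))
  have hG : Measurable G := Measurable.indicator (by fun_prop) hS
  have hB : MeasurableSet {p : ℝ × (Fin N → ℝ) | p.1 ∈ J ∧ p.1⁻¹ • p.2 ∈ D} :=
    (measurable_fst hJ).inter ((measurable_fst.inv.smul measurable_snd) hD)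
  have hE : MeasurableSet {x | (partialSums N x).1 ∈ J ∧
        (partialSums N x).1⁻¹ • (partialSums N x).2 ∈ D} := hΨ.measurable hB
  rw [expPi_eq_withDensity, withDensity_apply _ hE, ← lintegral_indicator hE]
  have h1 : ∀ x : Fin (N + 1) → ℝ, {x | (partialSums N x).1 ∈ J ∧
        (partialSums N x).1⁻¹ • (partialSums N x).2 ∈ D}.indicator (fun x : Fin (N + 1) → ℝ =>
        if ∀ i, 0 ≤ x i then ENNReal.ofReal (Real.exp (-∑ i, x i)) else 0) x =
      G (partialSums N x) := by
    intro x
    simp only [G, S, indicator, mem_ofPred_eq]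
    simp only [← forall_nonneg_iff_partialSums]
    by_cases hx : ∀ i, 0 ≤ x i
    · simp only [hx, implies_true, true_and, if_true]; rfl
    · simp [hx]
  rw [lintegral_congr h1, hΨ.lintegral_comp hG, Measure.volume_eq_prod,
    lintegral_prod _ hG.aemeasurable, ← lintegral_mul_const _ (by fun_prop),
    ← lintegral_indicator (hJ.inter measurableSet_Ioi)]
  refine lintegral_congr_ae ?_
  filter_upwards [measure_eq_zero_iff_ae_notMem.1 (Real.volume_singleton (a := 0))] with s hs0
  have hs0 : s ≠ 0 := hs0
  by_cases hs : s ∈ J ∩ Ioi 0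
  · rw [indicator_of_mem hs]
    have hpos : 0 < s := hs.2
    have h2 : ∀ y : Fin N → ℝ, G (s, y) = ((fun y => s⁻¹ • y) ⁻¹' sortedPart D).indicator
        (fun _ => ENNReal.ofReal (Real.exp (-s))) y := by
      intro y
      have : (s, y) ∈ S ↔ y ∈ (fun y => s⁻¹ • y) ⁻¹' sortedPart D := by
        simp only [S, sortedPart, mem_ofPred_eq, mem_preimage, hs.1, hpos.le, and_true, true_and]
        have hm : Monotone y ↔ Monotone (s⁻¹ • y) := by
          constructor
          · intro h i j hij
            exact mul_le_mul_of_nonneg_left (h hij) (inv_pos.2 hpos).le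
          · intro h i j hij
            exact le_of_mul_le_mul_left (h hij) (inv_pos.2 hpos)
        have hi : ∀ i, (0 ≤ y i ∧ y i ≤ s) ↔ (s⁻¹ • y) i ∈ Icc (0 : ℝ) 1 := by
          intro i
          simp only [Pi.smul_apply, smul_eq_mul, mem_Icc]
          rw [inv_mul_le_iff₀ hpos, mul_one, inv_mul_eq_div, div_nonneg_iff]
          constructor
          · rintro ⟨a, b⟩; exact ⟨Or.inl ⟨a, hpos.le⟩, b⟩
          · rintro ⟨a | a, b⟩
            · exact ⟨a.1, b⟩
            · linarith [a.2]
        rw [hm, forall_congr' hi]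
        tauto
      simp only [G, indicator, this]
    rw [lintegral_congr h2, lintegral_indicator
      ((measurable_const_smul _) (measurableSet_sortedPart hD)), setLIntegral_const,
      Measure.addHaar_preimage_smul _ (inv_ne_zero hs0), Real.exp_neg,
      ENNReal.ofReal_mul (inv_pos.2 (Real.exp_pos _)).le, mul_assoc]
    simp [abs_of_pos hpos]
  · rw [indicator_of_notMem hs]
    have : ∀ y : Fin N → ℝ, G (s, y) = 0 := by
      intro y
      refine indicator_of_notMem (fun h => hs ⟨h.2.1, ?_⟩) _
      exact lt_of_le_of_ne h.1.2.2 hs0.symm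
    simp [this]

/-! ### Order statistics of uniform variables as normalized partial sums -/

theorem lintegral_exp_neg_mul_pow (N : ℕ) :
    ∫⁻ s in Ioi (0 : ℝ), ENNReal.ofReal (Real.exp (-s) * s ^ N) = (N.factorial : ℝ≥0∞) := by
  have hint := Real.GammaIntegral_convergent (s := (N : ℝ) + 1) (by positivity)
  have hG := Real.Gamma_eq_integral (s := (N : ℝ) + 1) (by positivity)
  simp only [add_sub_cancel_right, Real.rpow_natCast] at hint hG
  rw [← ofReal_integral_eq_lintegral_ofReal hint, ← hG, Real.Gamma_nat_eq_factorial]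
  · simp
  · filter_upwards [ae_restrict_mem measurableSet_Ioi] with s hs
    have : (0 : ℝ) < s := hs
    positivity

/-- The volume `1 / N!` of the simplex of increasing tuples, read off from the total mass of the
exponential law. -/
theorem factorial_mul_volume_sortedPart_univ (N : ℕ) :
    (N.factorial : ℝ≥0∞) * volume (sortedPart (univ : Set (Fin N → ℝ))) = 1 := by
  have h := expPi_partialSums N (D := univ) MeasurableSet.univ (J := univ) MeasurableSet.univ
  simp only [mem_univ, and_self, univ_inter, lintegral_exp_neg_mul_pow] at h
  rw [← h]
  exact measure_univ

/-- The total of `N + 1` standard exponential variables has the Gamma density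
`exp (-s) * s ^ N / N!`. -/
theorem factorial_mul_expPi_sum_mem (N : ℕ) {J : Set ℝ} (hJ : MeasurableSet J) :
    (N.factorial : ℝ≥0∞) * expPi (N + 1) {x | ∑ j, x j ∈ J} =
      ∫⁻ s in J ∩ Ioi 0, ENNReal.ofReal (Real.exp (-s) * s ^ N) := by
  have h := expPi_partialSums N (D := univ) MeasurableSet.univ hJ
  simp only [mem_univ, and_true] at h
  change expPi (N + 1) {x | ∑ j, x j ∈ J} = _ at h
  rw [h, mul_left_comm, factorial_mul_volume_sortedPart_univ, mul_one]

theorem expPi_partialSums_eq_mul (N : ℕ) {D : Set (Fin N → ℝ)} (hD : MeasurableSet D) {J : Set ℝ}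
    (hJ : MeasurableSet J) :
    expPi (N + 1) {x | (partialSums N x).1 ∈ J ∧
        (partialSums N x).1⁻¹ • (partialSums N x).2 ∈ D} =
      (N.factorial * volume (sortedPart D)) * expPi (N + 1) {x | ∑ j, x j ∈ J} := by
  rw [expPi_partialSums N hD hJ, ← factorial_mul_expPi_sum_mem N hJ]
  ring

theorem volume_not_injective (N : ℕ) : volume {u : Fin N → ℝ | ¬ Function.Injective u} = 0 := by
  have hsub : {u : Fin N → ℝ | ¬ Function.Injective u} ⊆
      ⋃ i : Fin N, ⋃ j : Fin N, {u | u i = u j ∧ i ≠ j} := by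
    intro u hu
    simp only [mem_ofPred_eq, Function.Injective, not_forall] at hu
    obtain ⟨i, j, hij, hne⟩ := hu
    simp only [mem_iUnion]
    exact ⟨i, j, hij, hne⟩
  refine measure_mono_null hsub (measure_iUnion_null fun i => measure_iUnion_null fun j => ?_)
  by_cases hij : i = j
  · simp [hij]
  let L : (Fin N → ℝ) →ₗ[ℝ] ℝ := (LinearMap.proj i : (Fin N → ℝ) →ₗ[ℝ] ℝ) - LinearMap.proj j
  refine measure_mono_null (t := (LinearMap.ker L : Set (Fin N → ℝ))) ?_
    (Measure.addHaar_submodule _ _ ?_)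
  · rintro u ⟨h, -⟩
    simp [L, h]
  · intro h
    have : L (Pi.single i 1) = 0 := by
      rw [LinearMap.ker_eq_top] at h
      simp [h]
    simp [L, Ne.symm hij] at this

theorem measurePreserving_comp_perm {N : ℕ} (σ : Equiv.Perm (Fin N)) :
    MeasurePreserving (fun u : Fin N → ℝ => u ∘ σ) volume volume := by
  have h := volume_measurePreserving_piCongrLeft (fun _ : Fin N => ℝ) σ.symm
  convert h using 1
  ext u i
  have := Equiv.piCongrLeft_apply_apply (fun _ : Fin N => ℝ) σ.symm u (σ i)
  simp at this
  simp [MeasurableEquiv.piCongrLeft, this]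

/-- The increasing rearrangement of a tuple. -/
noncomputable def sorted {N : ℕ} (u : Fin N → ℝ) : Fin N → ℝ := u ∘ Tuple.sort u

/-- Avoiding the specific sorting permutation makes events about the rearrangement visibly
measurable. -/
theorem sorted_mem_iff {N : ℕ} (D : Set (Fin N → ℝ)) (u : Fin N → ℝ) :
    sorted u ∈ D ↔ ∃ σ : Equiv.Perm (Fin N), Monotone (u ∘ σ) ∧ u ∘ σ ∈ D := by
  constructor
  · intro h
    exact ⟨Tuple.sort u, Tuple.monotone_sort u, h⟩
  · rintro ⟨σ, h1, h2⟩
    rwa [Tuple.comp_sort_eq_comp_iff_monotone.2 h1] at h2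

theorem measurableSet_sorted_mem {N : ℕ} {D : Set (Fin N → ℝ)} (hD : MeasurableSet D) :
    MeasurableSet {u : Fin N → ℝ | sorted u ∈ D} := by
  simp only [sorted_mem_iff, ofPred_exists]
  exact MeasurableSet.iUnion fun σ => (measurePreserving_comp_perm σ).measurable
    ((measurableSet_monotone N).inter hD)

/-- The cube is, up to a null set, the disjoint union of `N!` congruent chambers, one for each
ordering of the coordinates. -/
theorem volume_sorted_mem {N : ℕ} {D : Set (Fin N → ℝ)} (hD : MeasurableSet D) :
    (volume.restrict (univ.pi fun _ => Icc (0 : ℝ) 1)) {u : Fin N → ℝ | sorted u ∈ D} =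
      N.factorial * volume (sortedPart D) := by
  rw [Measure.restrict_apply (measurableSet_sorted_mem hD)]
  have hU : {u : Fin N → ℝ | sorted u ∈ D} ∩ (univ.pi fun _ => Icc (0 : ℝ) 1) =
      ⋃ σ : Equiv.Perm (Fin N), (fun u : Fin N → ℝ => u ∘ σ) ⁻¹' sortedPart D := by
    ext u
    simp only [mem_inter_iff, mem_ofPred_eq, sorted_mem_iff, mem_univ_pi, mem_iUnion, mem_preimage,
      sortedPart, Function.comp_apply]
    constructor
    · rintro ⟨⟨σ, h1, h2⟩, h3⟩
      exact ⟨σ, h2, h1, fun i => h3 _⟩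
    · rintro ⟨σ, h2, h1, h3⟩
      exact ⟨⟨σ, h1, h2⟩, fun i => by simpa using h3 (σ.symm i)⟩
  rw [hU, measure_iUnion₀]
  · simp_rw [(measurePreserving_comp_perm _).measure_preimage
      (measurableSet_sortedPart hD).nullMeasurableSet]
    rw [tsum_fintype, Finset.sum_const, Finset.card_univ, Fintype.card_perm, Fintype.card_fin,
      nsmul_eq_mul]
  · intro σ τ hne
    refine measure_mono_null (fun u hu => ?_) (volume_not_injective N)
    intro hinj
    apply hne
    have h := Tuple.unique_monotone (σ := σ) (τ := τ) hu.1.2.1 hu.2.2.1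
    ext i
    exact congrArg Fin.val (hinj (congrFun h i))
  · exact fun σ => ((measurePreserving_comp_perm σ).measurable
      (measurableSet_sortedPart hD)).nullMeasurableSet

variable {Ω : Type*} [MeasurableSpace Ω] {P : Measure Ω} {U : ℕ → Ω → ℝ}

theorem IsIIDUniform.map_eq (hU : IsIIDUniform P U) [IsProbabilityMeasure P] (N : ℕ) :
    P.map (fun ω (j : Fin N) => U j ω) = volume.restrict (univ.pi fun _ => Icc (0 : ℝ) 1) := by
  have hind : iIndepFun (fun j : Fin N => U j) P := hU.indep.precomp Fin.val_injective
  rw [(iIndepFun_iff_map_fun_eq_pi_map fun j : Fin N => (hU.measurable j).aemeasurable).1 hind,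
    volume_pi, Measure.restrict_pi_pi]
  congr 1
  ext1 j
  rw [hU.uniform j, ProbabilityTheory.cond]
  simp

theorem IsIIDUniform.measure_sorted_mem (hU : IsIIDUniform P U) [IsProbabilityMeasure P] {N : ℕ}
    {D : Set (Fin N → ℝ)} (hD : MeasurableSet D) :
    P {ω | sorted (fun j : Fin N => U j ω) ∈ D} = N.factorial * volume (sortedPart D) := by
  rw [← volume_sorted_mem hD, ← hU.map_eq,
    Measure.map_apply (measurable_pi_lambda _ fun j => hU.measurable _) (measurableSet_sorted_mem hD)]
  rfl

/-- The normalized partial sums of exponential variables have the law of the order statistics of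
uniform variables and are independent of the total. -/
theorem IsIIDUniform.measure_mul_expPi (hU : IsIIDUniform P U) [IsProbabilityMeasure P] {N : ℕ}
    {D : Set (Fin N → ℝ)} (hD : MeasurableSet D) {J : Set ℝ} (hJ : MeasurableSet J) :
    P {ω | sorted (fun j : Fin N => U j ω) ∈ D} * expPi (N + 1) {x | ∑ j, x j ∈ J} =
      expPi (N + 1) {x | ∑ j, x j ∈ J ∧
        (fun i : Fin N => (∑ j ∈ Finset.Iic i.castSucc, x j) / ∑ j, x j) ∈ D} := by
  rw [hU.measure_sorted_mem hD, ← expPi_partialSums_eq_mul N hD hJ]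
  have h : ∀ x : Fin (N + 1) → ℝ, (fun i : Fin N => (∑ j ∈ Finset.Iic i.castSucc, x j) / ∑ j, x j) =
      (partialSums N x).1⁻¹ • (partialSums N x).2 := by
    intro x
    ext i
    simp [partialSums, div_eq_inv_mul]
  simp only [h]
  rfl

/-! ### Gamma tails, windows and blocks of exponential variables -/

/-- The tail probability `P(X ≥ y)` of a Gamma variable `X` of integer shape `m` and rate `1`,
for `y ≥ 0`. -/
noncomputable def gammaTail (m : ℕ) (y : ℝ) : ℝ :=
  Real.exp (-y) * ∑ j ∈ Finset.range m, y ^ j / (j.factorial : ℝ)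

theorem hasDerivAt_gammaTail (N : ℕ) (y : ℝ) :
    HasDerivAt (gammaTail (N + 1)) (-(Real.exp (-y) * y ^ N / (N.factorial : ℝ))) y := by
  induction N with
  | zero =>
    have : gammaTail (0 + 1) = fun y => Real.exp (-y) := by ext; simp [gammaTail]
    rw [this]
    simpa using (hasDerivAt_neg y).exp
  | succ N ih =>
    have h1 : gammaTail (N + 1 + 1) = fun y => gammaTail (N + 1) y +
        Real.exp (-y) * (y ^ (N + 1) / ((N + 1).factorial : ℝ)) := by
      ext y
      rw [gammaTail, Finset.sum_range_succ, mul_add]; rfl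
    rw [h1]
    have h2 := ih.add (((hasDerivAt_neg y).exp).mul
      ((hasDerivAt_pow (N + 1) y).div_const ((N + 1).factorial : ℝ)))
    refine h2.congr_deriv ?_
    have : (N.factorial : ℝ) ≠ 0 := by positivity
    rw [Nat.factorial_succ]
    push_cast
    have : (N : ℝ) + 1 ≠ 0 := by positivity
    field_simp
    ring

theorem tendsto_gammaTail_atTop (m : ℕ) :
    Filter.Tendsto (gammaTail m) Filter.atTop (nhds 0) := by
  have : gammaTail m = fun y => ∑ j ∈ Finset.range m,
      (y ^ j * Real.exp (-y)) * ((j.factorial : ℝ))⁻¹ := by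
    ext y
    rw [gammaTail, Finset.mul_sum]
    exact Finset.sum_congr rfl fun j _ => by ring
  rw [this]
  simpa using tendsto_finsetSum (Finset.range m) fun j _ =>
    (Real.tendsto_pow_mul_exp_neg_atTop_nhds_zero j).mul_const ((j.factorial : ℝ))⁻¹

theorem expPi_le_sum (N : ℕ) {y : ℝ} (hy : 0 < y) :
    expPi (N + 1) {x | y ≤ ∑ j, x j} = ENNReal.ofReal (gammaTail (N + 1) y) := by
  have hfac : (0 : ℝ) < N.factorial := by positivity
  have hderiv : ∀ s ∈ Ici y, HasDerivAt (fun s => -(N.factorial * gammaTail (N + 1) s))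
      (Real.exp (-s) * s ^ N) s := by
    intro s _
    refine (((hasDerivAt_gammaTail N s).const_mul (N.factorial : ℝ)).neg).congr_deriv ?_
    field_simp
  have hpos : ∀ s ∈ Ioi y, 0 ≤ Real.exp (-s) * s ^ N := by
    intro s hs
    have : 0 < s := hy.trans hs
    positivity
  have hlim : Filter.Tendsto (fun s => -(N.factorial * gammaTail (N + 1) s)) Filter.atTop
      (nhds 0) := by
    simpa using ((tendsto_gammaTail_atTop (N + 1)).const_mul (N.factorial : ℝ)).neg
  have hint := integrableOn_Ioi_deriv_of_nonneg' hderiv hpos hlim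
  have hval := integral_Ioi_of_hasDerivAt_of_nonneg' hderiv hpos hlim
  have h := factorial_mul_expPi_sum_mem N (measurableSet_Ici (a := y))
  have hset : Ici y ∩ Ioi 0 = Ici y := inter_eq_left.2 fun s hs => hy.trans_le hs
  rw [hset, setLIntegral_congr Ioi_ae_eq_Ici.symm, ← ofReal_integral_eq_lintegral_ofReal hint,
    hval, zero_sub, neg_neg, ENNReal.ofReal_mul hfac.le, ENNReal.ofReal_natCast] at h
  · exact (ENNReal.mul_right_inj (by exact_mod_cast hfac.ne') (ENNReal.natCast_ne_top _)).1 h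
  · filter_upwards [ae_restrict_mem measurableSet_Ioi] with s hs using hpos s hs

theorem gammaTail_nonneg (m : ℕ) {y : ℝ} (hy : 0 ≤ y) : 0 ≤ gammaTail m y := by
  unfold gammaTail; positivity

theorem expPi_real_le_sum {m : ℕ} (hm : 1 ≤ m) {y : ℝ} (hy : 0 < y) :
    (expPi m).real {x | y ≤ ∑ j, x j} = gammaTail m y := by
  obtain ⟨N, rfl⟩ := Nat.exists_eq_add_of_le' hm
  rw [measureReal_def, expPi_le_sum N hy, ENNReal.toReal_ofReal (gammaTail_nonneg _ hy.le)]

/-- Chebyshev's inequality for the total of `N + 1` standard exponential variables, whose mean and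
variance are both `N + 1`. -/
theorem expPi_real_abs_sum_sub_ge (N : ℕ) {c : ℝ} (hc : 0 < c) :
    (expPi (N + 1)).real {x | c ≤ |∑ j, x j - (N + 1)|} ≤ (N + 1) / c ^ 2 := by
  have hfac : (0 : ℝ) < N.factorial := by positivity
  have hI : ∀ a : ℕ, IntegrableOn (fun s : ℝ => Real.exp (-s) * s ^ a) (Ioi 0) ∧
      ∫ s in Ioi (0 : ℝ), Real.exp (-s) * s ^ a = a.factorial := by
    intro a
    have hint := Real.GammaIntegral_convergent (s := (a : ℝ) + 1) (by positivity)
    have hG := Real.Gamma_eq_integral (s := (a : ℝ) + 1) (by positivity)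
    simp only [add_sub_cancel_right, Real.rpow_natCast] at hint hG
    exact ⟨hint, by rw [← hG, Real.Gamma_nat_eq_factorial]⟩
  set k : ℝ := N + 1 with hk
  let F : ℝ → ℝ := fun s => (s - k) ^ 2 * (Real.exp (-s) * s ^ N)
  have hF : F = fun s => (Real.exp (-s) * s ^ (N + 2) - 2 * k * (Real.exp (-s) * s ^ (N + 1))) +
      k ^ 2 * (Real.exp (-s) * s ^ N) := by
    ext s; simp only [F]; ring
  have hFint : IntegrableOn F (Ioi 0) := by
    rw [hF]
    exact ((hI _).1.sub ((hI _).1.const_mul _)).add ((hI _).1.const_mul _)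
  have hFval : ∫ s in Ioi (0 : ℝ), F s = N.factorial * k := by
    have h1 : IntegrableOn (fun s => Real.exp (-s) * s ^ (N + 2) -
        2 * k * (Real.exp (-s) * s ^ (N + 1))) (Ioi 0) := (hI _).1.sub ((hI _).1.const_mul _)
    rw [hF, integral_add h1 ((hI _).1.const_mul _), integral_sub (hI _).1 ((hI _).1.const_mul _),
      integral_const_mul, integral_const_mul, (hI _).2, (hI _).2, (hI _).2]
    simp only [Nat.factorial_succ]
    push_cast
    rw [hk]
    ring
  have hJ : MeasurableSet {s : ℝ | c ≤ |s - k|} := measurableSet_le measurable_const (by fun_prop)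
  have h := factorial_mul_expPi_sum_mem N hJ
  have hle : ∫⁻ s in {s : ℝ | c ≤ |s - k|} ∩ Ioi 0, ENNReal.ofReal (Real.exp (-s) * s ^ N) ≤
      ENNReal.ofReal (N.factorial * (k / c ^ 2)) := by
    calc _ ≤ ∫⁻ s in {s : ℝ | c ≤ |s - k|} ∩ Ioi 0, ENNReal.ofReal (F s * (c ^ 2)⁻¹) := by
          refine setLIntegral_mono' (hJ.inter measurableSet_Ioi) fun s hs => ?_
          refine ENNReal.ofReal_le_ofReal ?_
          have hs0 : (0 : ℝ) < s := hs.2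
          have hsc : c ≤ |s - k| := hs.1
          have : c ^ 2 ≤ (s - k) ^ 2 := by
            rw [← sq_abs (s - k)]; gcongr
          rw [← div_eq_mul_inv, le_div_iff₀ (by positivity), mul_comm]
          exact mul_le_mul_of_nonneg_right this (by positivity)
      _ ≤ ∫⁻ s in Ioi 0, ENNReal.ofReal (F s * (c ^ 2)⁻¹) := lintegral_mono_set inter_subset_right
      _ = _ := by
          rw [← ofReal_integral_eq_lintegral_ofReal (hFint.mul_const _), integral_mul_const, hFval]
          · congr 1; ring
          · filter_upwards [ae_restrict_mem measurableSet_Ioi] with s hs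
            have hs0 : (0 : ℝ) < s := hs
            simp only [Pi.zero_apply, F]
            positivity
  rw [← h, ENNReal.ofReal_mul hfac.le, ENNReal.ofReal_natCast] at hle
  have h2 := (ENNReal.mul_le_mul_iff_right (by exact_mod_cast hfac.ne')
    (ENNReal.natCast_ne_top _)).1 hle
  exact ENNReal.toReal_le_of_le_ofReal (by positivity) h2

/-- Distinct coordinates of a sample are again a sample. -/
theorem map_comp_pi {ι κ : Type*} [Fintype ι] [Fintype κ] (μ : Measure ℝ) [IsProbabilityMeasure μ]
    {e : κ → ι} (he : Function.Injective e) :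
    (Measure.pi fun _ : ι => μ).map (fun x => x ∘ e) = Measure.pi fun _ : κ => μ := by
  have h1 : iIndepFun (fun (i : ι) (x : ι → ℝ) => x i) (Measure.pi fun _ : ι => μ) :=
    iIndepFun_pi (X := fun _ => id) fun _ => aemeasurable_id
  have h2 := h1.precomp he
  have h3 := (iIndepFun_iff_map_fun_eq_pi_map
    fun j : κ => (measurable_pi_apply (e j)).aemeasurable).1 h2
  change Measure.map (fun (x : ι → ℝ) (j : κ) => x (e j)) _ = _
  rw [h3]
  congr 1
  ext1 j
  exact (measurePreserving_eval (fun _ : ι => μ) (e j)).map_eq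

/-- The sum of the `m` consecutive coordinates that start at index `i`. -/
noncomputable def windowSum {k : ℕ} (x : Fin k → ℝ) (i m : ℕ) : ℝ :=
  ∑ j ∈ Finset.univ.filter fun j : Fin k => i ≤ (j : ℕ) ∧ (j : ℕ) < i + m, x j

theorem windowSum_eq {k : ℕ} (x : Fin k → ℝ) {i m : ℕ} (h : i + m ≤ k) :
    windowSum x i m = ∑ l : Fin m, x ⟨i + l, by omega⟩ := by
  symm
  refine Finset.sum_bij (fun l _ => ⟨i + l, by omega⟩) ?_ ?_ ?_ ?_
  · intro l _; simp
  · intro a _ b _ hab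
    ext
    simpa using hab
  · intro j hj
    simp only [Finset.mem_filter, Finset.mem_univ, true_and] at hj
    exact ⟨⟨j - i, by omega⟩, Finset.mem_univ _, by ext; simp; omega⟩
  · intro l _; rfl

theorem expPi_real_le_windowSum {k m i : ℕ} (hm : 1 ≤ m) (h : i + m ≤ k) {y : ℝ} (hy : 0 < y) :
    (expPi k).real {x | y ≤ windowSum x i m} = gammaTail m y := by
  rw [← expPi_real_le_sum hm hy, expPi, expPi, ← map_comp_pi (ι := Fin k) (κ := Fin m) (expMeasure 1)
    (e := fun l => ⟨i + l, by omega⟩) (fun a b hab => by ext; simpa using hab),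
    map_measureReal_apply (by fun_prop) (measurableSet_le measurable_const (by fun_prop))]
  simp only [windowSum_eq _ h]
  rfl

theorem measurable_windowSum (k i m : ℕ) : Measurable fun x : Fin k → ℝ => windowSum x i m := by
  unfold windowSum
  fun_prop

/-- The `n` disjoint blocks of `m` exponential variables are independent Gamma variables. -/
theorem expPi_real_forall_windowSum_lt {m : ℕ} (hm : 1 ≤ m) (n : ℕ) {k : ℕ} (hk : k = m * n)
    {y : ℝ} (hy : 0 < y) :
    (expPi k).real {x | ∀ i < n, windowSum x (i * m) m < y} = (1 - gammaTail m y) ^ n := by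
  have hidx : ∀ p : Fin n × Fin m, (p.1 : ℕ) * m + p.2 < k := by
    intro p
    calc (p.1 : ℕ) * m + p.2 < (p.1 : ℕ) * m + m := by omega
      _ = (p.1 + 1) * m := by ring
      _ ≤ n * m := Nat.mul_le_mul_right _ p.1.2
      _ = k := by rw [hk, mul_comm]
  let e : Fin n × Fin m → Fin k := fun p => ⟨(p.1 : ℕ) * m + p.2, hidx p⟩
  have he : Function.Injective e := by
    rintro ⟨a, b⟩ ⟨c, d⟩ h
    have h : (a : ℕ) * m + b = c * m + d := by simpa [e] using h
    have hb : (b : ℕ) = d := by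
      have := congrArg (· % m) h
      simpa [Nat.mul_add_mod', Nat.mod_eq_of_lt] using this
    have ha : (a : ℕ) = c := by
      rw [hb] at h
      exact Nat.eq_of_mul_eq_mul_right (by omega) (Nat.add_right_cancel h)
    ext <;> assumption
  have hmap := map_comp_pi (expMeasure 1) he
  have hcurry := Measure.infinitePi_map_curry (fun (_ : Fin n) (_ : Fin m) => expMeasure 1)
  simp only [Measure.infinitePi_eq_pi] at hcurry
  let A : Set (Fin m → ℝ) := {z | ∑ l, z l < y}
  have hA : MeasurableSet A := measurableSet_lt (by fun_prop) measurable_const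
  have hset : {x : Fin k → ℝ | ∀ i < n, windowSum x (i * m) m < y} =
      (fun x => MeasurableEquiv.curry (Fin n) (Fin m) ℝ (x ∘ e)) ⁻¹' (univ.pi fun _ => A) := by
    ext x
    simp only [mem_ofPred_eq, mem_preimage, mem_univ_pi, A]
    have hw : ∀ i : Fin n, windowSum x (i * m) m = ∑ l, x (e (i, l)) := by
      intro i
      refine windowSum_eq x ?_
      calc (i : ℕ) * m + m = (i + 1) * m := by ring
        _ ≤ n * m := Nat.mul_le_mul_right _ i.2
        _ = k := by rw [hk, mul_comm]
    constructor
    · intro h i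
      have := h i i.2
      rw [hw] at this
      exact this
    · intro h i hi
      rw [hw ⟨i, hi⟩]
      exact h ⟨i, hi⟩
  have hAval : (expPi m).real A = 1 - gammaTail m y := by
    rw [← expPi_real_le_sum hm hy, ← probReal_compl_eq_one_sub]
    · congr 1
      ext z
      simp [A]
    · exact measurableSet_le measurable_const (by fun_prop)
  have hcm : Measurable (fun x : Fin k → ℝ => x ∘ e) := by fun_prop
  rw [hset, ← map_measureReal_apply (f := fun x : Fin k → ℝ =>
      MeasurableEquiv.curry (Fin n) (Fin m) ℝ (x ∘ e)) ((MeasurableEquiv.measurable _).comp hcm)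
      (MeasurableSet.univ_pi fun _ => hA), expPi,
    show (fun x : Fin k → ℝ => MeasurableEquiv.curry (Fin n) (Fin m) ℝ (x ∘ e)) =
      MeasurableEquiv.curry (Fin n) (Fin m) ℝ ∘ fun x : Fin k → ℝ => x ∘ e from rfl,
    ← Measure.map_map (MeasurableEquiv.measurable _) hcm, hmap, hcurry, measureReal_def,
    Measure.pi_pi, ENNReal.toReal_prod, ← hAval]
  simp [measureReal_def, expPi]

/-! ### Transfer from exponential to uniform spacings -/

/-- The tuple `y` with the endpoints `0` (at index `0`) and `1` (beyond the last index) adjoined. -/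
noncomputable def withEndpoints {N : ℕ} (y : Fin N → ℝ) (i : ℕ) : ℝ :=
  if i = 0 then 0 else if h : i - 1 < N then y ⟨i - 1, h⟩ else 1

theorem orderStat_eq (N : ℕ) (u : ℕ → ℝ) (i : ℕ) :
    orderStat N u i = withEndpoints (sorted fun j : Fin N => u j) i := rfl

@[simp] theorem withEndpoints_zero {N : ℕ} (y : Fin N → ℝ) : withEndpoints y 0 = 0 := by
  simp [withEndpoints]

@[simp] theorem withEndpoints_succ {N : ℕ} (y : Fin N → ℝ) (l : Fin N) :
    withEndpoints y (l + 1) = y l := by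
  simp [withEndpoints]

theorem withEndpoints_of_lt {N : ℕ} (y : Fin N → ℝ) {i : ℕ} (h : N < i) :
    withEndpoints y i = 1 := by
  unfold withEndpoints
  rw [if_neg (by omega), dif_neg (by omega)]

theorem measurable_withEndpoints (N i : ℕ) :
    Measurable fun y : Fin N → ℝ => withEndpoints y i := by
  unfold withEndpoints
  split_ifs
  · exact measurable_const
  · exact measurable_pi_apply _
  · exact measurable_const

theorem monotone_withEndpoints {N : ℕ} {y : Fin N → ℝ} (hy : Monotone y)
    (h01 : ∀ l, y l ∈ Icc (0 : ℝ) 1) : Monotone (withEndpoints y) := by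
  have hmem : ∀ i, withEndpoints y i ∈ Icc (0 : ℝ) 1 := by
    intro i
    unfold withEndpoints
    split_ifs
    · simp
    · exact h01 _
    · simp
  intro i j hij
  rcases Nat.eq_zero_or_pos i with rfl | hi
  · simpa using (hmem j).1
  rcases lt_or_ge N j with hj | hj
  · rw [withEndpoints_of_lt y hj]; exact (hmem i).2
  · obtain ⟨i, rfl⟩ := Nat.exists_eq_add_of_le' hi
    obtain ⟨j, rfl⟩ := Nat.exists_eq_add_of_le' (show 1 ≤ j by omega)
    rw [withEndpoints_succ y ⟨i, by omega⟩, withEndpoints_succ y ⟨j, by omega⟩]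
    exact hy (by simp; omega)

/-- The order statistics built from exponential variables, rescaled by the total, are the partial
sums, endpoints included. -/
theorem withEndpoints_normalized {N : ℕ} {x : Fin (N + 1) → ℝ} (hx : ∑ j, x j ≠ 0) {i : ℕ}
    (hi : i ≤ N + 1) :
    withEndpoints (fun i : Fin N => (∑ j ∈ Finset.Iic i.castSucc, x j) / ∑ j, x j) i * ∑ j, x j =
      windowSum x 0 i := by
  rcases Nat.eq_zero_or_pos i with rfl | h0
  · simp [windowSum]
  obtain ⟨i, rfl⟩ := Nat.exists_eq_add_of_le' h0
  rcases (show i < N ∨ i = N by omega) with h | rfl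
  · rw [withEndpoints_succ _ ⟨i, h⟩, div_mul_cancel₀ _ hx, windowSum]
    refine Finset.sum_congr ?_ fun _ _ => rfl
    ext j
    simp only [Finset.mem_Iic, Finset.mem_filter, Finset.mem_univ, true_and, Fin.le_def,
      Fin.val_castSucc]
    omega
  · rw [withEndpoints_of_lt _ (Nat.lt_succ_self _), one_mul, windowSum]
    refine Finset.sum_congr ?_ fun _ _ => rfl
    ext j
    simp
    omega

theorem windowSum_add {k : ℕ} (x : Fin k → ℝ) (i m : ℕ) :
    windowSum x 0 (i + m) = windowSum x 0 i + windowSum x i m := by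
  unfold windowSum
  rw [← Finset.sum_union]
  · refine Finset.sum_congr ?_ fun _ _ => rfl
    ext j
    simp only [Finset.mem_filter, Finset.mem_univ, true_and, Finset.mem_union]
    omega
  · refine Finset.disjoint_left.2 fun j => ?_
    simp only [Finset.mem_filter, Finset.mem_univ, true_and]
    omega

theorem withEndpoints_sub_mul {N : ℕ} {x : Fin (N + 1) → ℝ} (hx : ∑ j, x j ≠ 0) {i m : ℕ}
    (hi : i + m ≤ N + 1) :
    (withEndpoints (fun i : Fin N => (∑ j ∈ Finset.Iic i.castSucc, x j) / ∑ j, x j) (i + m) -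
      withEndpoints (fun i : Fin N => (∑ j ∈ Finset.Iic i.castSucc, x j) / ∑ j, x j) i) *
        ∑ j, x j = windowSum x i m := by
  rw [sub_mul, withEndpoints_normalized hx hi, withEndpoints_normalized hx (by omega),
    windowSum_add]
  ring

/-- If an event for order statistics, together with a total within `c` of its mean, forces an event
for exponential variables, then its probability is at most that of the latter, up to a factor close
to one. -/
theorem IsIIDUniform.measureReal_mul_le (hU : IsIIDUniform P U) [IsProbabilityMeasure P] {N : ℕ}
    {D : Set (Fin N → ℝ)} (hD : MeasurableSet D) {c : ℝ} (hc : 0 < c)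
    {E : Set (Fin (N + 1) → ℝ)}
    (hE : ∀ x : Fin (N + 1) → ℝ, ∑ j, x j ∈ Ioo ((N : ℝ) + 1 - c) (N + 1 + c) →
      (fun i : Fin N => (∑ j ∈ Finset.Iic i.castSucc, x j) / ∑ j, x j) ∈ D → x ∈ E) :
    P.real {ω | sorted (fun j : Fin N => U j ω) ∈ D} * (1 - (N + 1) / c ^ 2) ≤
      (expPi (N + 1)).real E := by
  have h := congrArg ENNReal.toReal
    (hU.measure_mul_expPi hD (measurableSet_Ioo (a := (N : ℝ) + 1 - c) (b := N + 1 + c)))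
  rw [ENNReal.toReal_mul] at h
  have hcheb : 1 - ((N : ℝ) + 1) / c ^ 2 ≤
      (expPi (N + 1)).real {x | ∑ j, x j ∈ Ioo ((N : ℝ) + 1 - c) (N + 1 + c)} := by
    have h1 := expPi_real_abs_sum_sub_ge N hc
    have h2 : {x : Fin (N + 1) → ℝ | c ≤ |∑ j, x j - (N + 1)|}ᶜ =
        {x | ∑ j, x j ∈ Ioo ((N : ℝ) + 1 - c) (N + 1 + c)} := by
      ext x
      simp only [mem_compl_iff, mem_ofPred_eq, not_le, abs_lt, mem_Ioo]
      constructor <;> rintro ⟨a, b⟩ <;> constructor <;> linarith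
    rw [← h2, probReal_compl_eq_one_sub (measurableSet_le measurable_const (by fun_prop))]
    linarith
  calc _ ≤ P.real {ω | sorted (fun j : Fin N => U j ω) ∈ D} *
        (expPi (N + 1)).real {x | ∑ j, x j ∈ Ioo ((N : ℝ) + 1 - c) (N + 1 + c)} :=
        mul_le_mul_of_nonneg_left hcheb measureReal_nonneg
    _ = _ := h
    _ ≤ _ := measureReal_mono fun x hx => hE x hx.1 hx.2

/-- For `n ≥ 1` the supremum defining the maximal block is attained, so strict inequalities may be
checked block by block. -/
theorem maxNonoverlapping_lt_iff {m n : ℕ} (hn : 1 ≤ n) (u : ℕ → ℝ) (t : ℝ) :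
    maxNonoverlapping m n u < t ↔ ∀ i < n,
      withEndpoints (sorted fun j : Fin (m * n - 1) => u j) (i * m + m) -
        withEndpoints (sorted fun j : Fin (m * n - 1) => u j) (i * m) < t := by
  have : Nonempty (Fin n) := ⟨⟨0, hn⟩⟩
  unfold maxNonoverlapping
  simp only [orderStat_eq, add_mul, one_mul]
  obtain ⟨i₀, hi₀⟩ := exists_eq_ciSup_of_finite (f := fun i : Fin n =>
    withEndpoints (sorted fun j : Fin (m * n - 1) => u j) (i * m + m) -
        withEndpoints (sorted fun j : Fin (m * n - 1) => u j) (i * m))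
  constructor
  · intro h i hi
    exact (le_ciSup (f := fun i : Fin n =>
      withEndpoints (sorted fun j : Fin (m * n - 1) => u j) (i * m + m) -
        withEndpoints (sorted fun j : Fin (m * n - 1) => u j) (i * m))
        (Set.finite_range _).bddAbove ⟨i, hi⟩).trans_lt h
  · intro h
    rw [← hi₀]
    exact h i₀ i₀.2

theorem measurableSet_forall_blocks_lt (N m n : ℕ) (t : ℝ) :
    MeasurableSet {y : Fin N → ℝ | ∀ i < n,
      withEndpoints y (i * m + m) - withEndpoints y (i * m) < t} := by
  simp only [ofPred_forall]
  exact MeasurableSet.iInter fun i => MeasurableSet.iInter fun _ => measurableSet_lt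
    ((measurable_withEndpoints _ _).sub (measurable_withEndpoints _ _)) measurable_const

theorem block_le {m n i : ℕ} (hi : i < n) : i * m + m ≤ m * n := by
  calc i * m + m = (i + 1) * m := by ring
    _ ≤ n * m := Nat.mul_le_mul_right _ hi
    _ = m * n := mul_comm _ _

/-- Upper bound for the distribution function of the maximal block. -/
theorem IsIIDUniform.measureReal_maxNonoverlapping_lt (hU : IsIIDUniform P U)
    [IsProbabilityMeasure P] {m n : ℕ} (hm : 1 ≤ m) (hn : 1 ≤ n) {t c : ℝ} (ht : 0 < t)
    (hc : 0 < c) (hck : c ≤ m * n) :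
    P.real {ω | maxNonoverlapping m n (fun i => U i ω) < t} * (1 - m * n / c ^ 2) ≤
      (1 - gammaTail m (t * (m * n + c))) ^ n := by
  obtain ⟨N, hN⟩ := Nat.exists_eq_add_of_le' (Nat.mul_pos hm hn : 1 ≤ m * n)
  have hNR : (m : ℝ) * n = N + 1 := by exact_mod_cast hN
  have hN1 : m * n - 1 = N := by omega
  have hset : {ω | maxNonoverlapping m n (fun i => U i ω) < t} =
      {ω | sorted (fun j : Fin N => U j ω) ∈ {y : Fin N → ℝ | ∀ i < n,
      withEndpoints y (i * m + m) - withEndpoints y (i * m) < t}} := by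
    ext ω
    rw [mem_ofPred_eq, maxNonoverlapping_lt_iff hn, hN1]
    rfl
  rw [hset]
  rw [hNR] at hck ⊢
  rw [← expPi_real_forall_windowSum_lt hm n hN.symm (y := t * (N + 1 + c)) (by positivity)]
  refine hU.measureReal_mul_le (measurableSet_forall_blocks_lt N m n t) hc fun x hx hD i hi => ?_
  have hpos : 0 < ∑ j, x j := by linarith [hx.1]
  rw [← withEndpoints_sub_mul hpos.ne' (by rw [← hN]; exact block_le hi)]
  calc _ < t * ∑ j, x j := mul_lt_mul_of_pos_right (hD i hi) hpos
    _ ≤ _ := mul_le_mul_of_nonneg_left hx.2.le ht.le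

/-- Upper bound for the tail of the maximal block. -/
theorem IsIIDUniform.measureReal_le_maxNonoverlapping (hU : IsIIDUniform P U)
    [IsProbabilityMeasure P] {m n : ℕ} (hm : 1 ≤ m) (hn : 1 ≤ n) {t c : ℝ} (ht : 0 < t)
    (hc : 0 < c) (hck : c < m * n) :
    P.real {ω | t ≤ maxNonoverlapping m n (fun i => U i ω)} * (1 - m * n / c ^ 2) ≤
      1 - (1 - gammaTail m (t * (m * n - c))) ^ n := by
  obtain ⟨N, hN⟩ := Nat.exists_eq_add_of_le' (Nat.mul_pos hm hn : 1 ≤ m * n)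
  have hNR : (m : ℝ) * n = N + 1 := by exact_mod_cast hN
  have hN1 : m * n - 1 = N := by omega
  have hset : {ω | t ≤ maxNonoverlapping m n (fun i => U i ω)} =
      {ω | sorted (fun j : Fin N => U j ω) ∈ {y : Fin N → ℝ | ∀ i < n,
      withEndpoints y (i * m + m) - withEndpoints y (i * m) < t}ᶜ} := by
    ext ω
    rw [mem_ofPred_eq, ← not_lt, maxNonoverlapping_lt_iff hn, hN1]
    rfl
  rw [hset]
  rw [hNR] at hck ⊢
  have hpos' : 0 < t * (N + 1 - c) := mul_pos ht (by linarith)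
  rw [← expPi_real_forall_windowSum_lt hm n hN.symm hpos', ← probReal_compl_eq_one_sub]
  · refine hU.measureReal_mul_le (measurableSet_forall_blocks_lt N m n t).compl hc
      fun x hx hD hall => hD fun i hi => ?_
    have hpos : 0 < ∑ j, x j := by linarith [hx.1]
    have h := hall i hi
    rw [← withEndpoints_sub_mul hpos.ne' (by rw [← hN]; exact block_le hi)] at h
    exact lt_of_mul_lt_mul_right (h.trans_le (mul_le_mul_of_nonneg_left hx.1.le ht.le)) hpos.le
  · simp only [ofPred_forall]
    exact MeasurableSet.iInter fun i => MeasurableSet.iInter fun _ => measurableSet_lt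
      (measurable_windowSum _ _ _) measurable_const

/-- Upper bound for the tail of the maximal overlapping `m`-spacing. -/
theorem IsIIDUniform.measureReal_exists_le_withEndpoints_sub (hU : IsIIDUniform P U)
    [IsProbabilityMeasure P] {m N : ℕ} (hm : 1 ≤ m) {t c : ℝ} (ht : 0 < t)
    (hc : 0 < c) (hck : c < N + 1) :
    P.real {ω | ∃ i, i + m ≤ N + 1 ∧ t ≤ withEndpoints (sorted fun j : Fin N => U j ω) (i + m) -
        withEndpoints (sorted fun j : Fin N => U j ω) i} * (1 - (N + 1) / c ^ 2) ≤
      (N + 1) * gammaTail m (t * (N + 1 - c)) := by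
  have hpos' : 0 < t * (N + 1 - c) := mul_pos ht (by linarith)
  have hD : MeasurableSet {y : Fin N → ℝ | ∃ i, i + m ≤ N + 1 ∧
      t ≤ withEndpoints y (i + m) - withEndpoints y i} := by
    simp only [ofPred_exists]
    exact MeasurableSet.iUnion fun i => (MeasurableSet.const _).inter (measurableSet_le
      measurable_const ((measurable_withEndpoints _ _).sub (measurable_withEndpoints _ _)))
  refine (hU.measureReal_mul_le hD hc (E := ⋃ i ∈ Finset.range (N + 2 - m),
    {x | t * (N + 1 - c) ≤ windowSum x i m}) ?_).trans ?_
  · rintro x hx ⟨i, hi, hti⟩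
    have hpos : 0 < ∑ j, x j := by linarith [hx.1]
    simp only [mem_iUnion, Finset.mem_range]
    refine ⟨i, by omega, ?_⟩
    rw [mem_ofPred_eq, ← withEndpoints_sub_mul hpos.ne' hi]
    calc _ ≤ t * ∑ j, x j := mul_le_mul_of_nonneg_left hx.1.le ht.le
      _ ≤ _ := mul_le_mul_of_nonneg_right hti hpos.le
  · refine (measureReal_biUnion_finset_le _ _).trans ?_
    rw [Finset.sum_congr rfl fun i hi => expPi_real_le_windowSum hm
      (show i + m ≤ N + 1 by have := Finset.mem_range.1 hi; omega) hpos', Finset.sum_const,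
      Finset.card_range, nsmul_eq_mul]
    refine mul_le_mul_of_nonneg_right ?_ (gammaTail_nonneg m hpos'.le)
    exact_mod_cast (show N + 2 - m ≤ N + 1 by omega)

/-! ### Intervals with few points -/

/-- Some interval `[a, b] ⊆ [0, 1]` of length at least `t` has fewer than `m` of the points
`u 0, …, u (N - 1)` in its interior. -/
def HasSparseInterval (m N : ℕ) (t : ℝ) (u : ℕ → ℝ) : Prop :=
  ∃ a b : ℝ, 0 ≤ a ∧ b ≤ 1 ∧ t ≤ b - a ∧
    ((Finset.range N).filter fun j => a < u j ∧ u j < b).card < m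

theorem HasSparseInterval.anti {m N N' : ℕ} (h : N ≤ N') {t : ℝ} {u : ℕ → ℝ}
    (hs : HasSparseInterval m N' t u) : HasSparseInterval m N t u := by
  obtain ⟨a, b, ha, hb, hab, hcard⟩ := hs
  refine ⟨a, b, ha, hb, hab, lt_of_le_of_lt (Finset.card_le_card ?_) hcard⟩
  exact Finset.filter_subset_filter _ (Finset.range_subset_range.2 h)

theorem card_filter_sorted (N : ℕ) (u : ℕ → ℝ) (p : ℝ → Prop) [DecidablePred p] :
    (Finset.univ.filter fun l : Fin N => p (sorted (fun j : Fin N => u j) l)).card =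
      ((Finset.range N).filter fun j => p (u j)).card := by
  rw [Finset.card_filter, Finset.card_filter, Finset.sum_range]
  exact Equiv.sum_comp (Tuple.sort fun j : Fin N => u j) fun j : Fin N => if p (u j) then 1 else 0

theorem sorted_mem_Icc {N : ℕ} {u : ℕ → ℝ} (hu : ∀ j, u j ∈ Icc (0 : ℝ) 1) (l : Fin N) :
    sorted (fun j : Fin N => u j) l ∈ Icc (0 : ℝ) 1 := hu _

/-- Strictly between two order statistics whose ranks differ by `m` lie at most `m - 1` points. -/
theorem hasSparseInterval_of_le_sub {m N i : ℕ} (hm : 1 ≤ m) {t : ℝ} {u : ℕ → ℝ}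
    (hu : ∀ j, u j ∈ Icc (0 : ℝ) 1)
    (h : t ≤ withEndpoints (sorted fun j : Fin N => u j) (i + m) -
      withEndpoints (sorted fun j : Fin N => u j) i) : HasSparseInterval m N t u := by
  have hmono := monotone_withEndpoints (y := sorted fun j : Fin N => u j)
    (Tuple.monotone_sort _) (sorted_mem_Icc hu)
  have h0 := hmono (Nat.zero_le i)
  have h1 := hmono (show i + m ≤ (i + m) + N + 1 by omega)
  rw [withEndpoints_zero] at h0
  rw [withEndpoints_of_lt _ (show N < i + m + N + 1 by omega)] at h1
  refine ⟨_, _, h0, h1, h, ?_⟩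
  have hc := card_filter_sorted N u fun z => withEndpoints (sorted fun j : Fin N => u j) i < z ∧
    z < withEndpoints (sorted fun j : Fin N => u j) (i + m)
  rw [← hc]
  have hle : (Finset.univ.filter fun l : Fin N =>
      withEndpoints (sorted fun j : Fin N => u j) i < sorted (fun j : Fin N => u j) l ∧
      sorted (fun j : Fin N => u j) l <
        withEndpoints (sorted fun j : Fin N => u j) (i + m)).card ≤
      (Finset.Ioo i (i + m)).card := by
    refine Finset.card_le_card_of_injOn (fun l => (l : ℕ) + 1) ?_ ?_
    · intro l hl
      simp only [Finset.coe_filter, Finset.mem_univ, true_and, mem_ofPred_eq] at hl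
      rw [← withEndpoints_succ (sorted fun j : Fin N => u j) l] at hl
      simp only [Finset.coe_Ioo, mem_Ioo]
      exact ⟨hmono.reflect_lt hl.1, hmono.reflect_lt hl.2⟩
    · intro a _ b _ hab
      ext
      simpa using hab
  rw [Nat.card_Ioo] at hle
  omega

/-- A sparse interval is covered by a window of `m` consecutive spacings. -/
theorem HasSparseInterval.exists_le_sub {m N : ℕ} (hmN : m ≤ N + 1) {t : ℝ} {u : ℕ → ℝ}
    (hu : ∀ j, u j ∈ Icc (0 : ℝ) 1) (hs : HasSparseInterval m N t u) :
    ∃ i, i + m ≤ N + 1 ∧ t ≤ withEndpoints (sorted fun j : Fin N => u j) (i + m) -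
      withEndpoints (sorted fun j : Fin N => u j) i := by
  classical
  have hmono := monotone_withEndpoints (y := sorted fun j : Fin N => u j)
    (Tuple.monotone_sort _) (sorted_mem_Icc hu)
  obtain ⟨a, b, ha, hb, hab, hcard⟩ := hs
  -- the last order statistic not exceeding `a`, among those followed by `m` further ones
  set i := Nat.findGreatest (fun i => withEndpoints (sorted fun j : Fin N => u j) i ≤ a) (N + 1 - m)
    with hi
  have hiN : i ≤ N + 1 - m := Nat.findGreatest_le _
  have hia : withEndpoints (sorted fun j : Fin N => u j) i ≤ a :=
    Nat.findGreatest_spec (P := fun i => withEndpoints (sorted fun j : Fin N => u j) i ≤ a)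
      (Nat.zero_le _) (by simpa using ha)
  refine ⟨i, by omega, ?_⟩
  suffices h : b ≤ withEndpoints (sorted fun j : Fin N => u j) (i + m) by linarith
  rcases hiN.eq_or_lt with h | h
  · rw [withEndpoints_of_lt _ (by omega)]; exact hb
  by_contra! hlt
  have hsucc : a < withEndpoints (sorted fun j : Fin N => u j) (i + 1) := by
    have := Nat.findGreatest_is_greatest (n := N + 1 - m) (k := i + 1)
      (P := fun i => withEndpoints (sorted fun j : Fin N => u j) i ≤ a) (by omega) (by omega)
    exact not_le.1 this
  have hc := card_filter_sorted N u fun z => a < z ∧ z < b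
  rw [← hc] at hcard
  refine absurd hcard (not_lt.2 ?_)
  have hle : (Finset.Ico i (i + m)).card ≤ (Finset.univ.filter fun l : Fin N =>
      a < sorted (fun j : Fin N => u j) l ∧ sorted (fun j : Fin N => u j) l < b).card := by
    refine Finset.card_le_card_of_injOn (fun l => if h : l < N then ⟨l, h⟩ else ⟨0, by omega⟩) ?_ ?_
    · intro l hl
      simp only [Finset.coe_Ico, mem_Ico] at hl
      have hlN : l < N := by omega
      simp only [Finset.coe_filter, Finset.mem_univ, true_and, mem_ofPred_eq, hlN, dite_true]
      rw [← withEndpoints_succ (sorted fun j : Fin N => u j) ⟨l, hlN⟩]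
      exact ⟨hsucc.trans_le (hmono (by simp; omega)), (hmono (by simp; omega)).trans_lt hlt⟩
    · intro l hl l' hl' hll
      simp only [Finset.coe_Ico, mem_Ico] at hl hl'
      have h1 : l < N := by omega
      have h2 : l' < N := by omega
      simpa [h1, h2] using hll
  simpa using hle

/-! ### The Gumbel limit -/

open Filter Topology

theorem tendsto_log_natCast : Tendsto (fun n : ℕ => Real.log n) atTop atTop :=
  Real.tendsto_log_atTop.comp tendsto_natCast_atTop_atTop

theorem tendsto_log_div_self : Tendsto (fun L : ℝ => Real.log L / L) atTop (𝓝 0) := by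
  simpa using Real.tendsto_pow_log_div_mul_add_atTop 1 0 1 one_ne_zero

/-- The centred argument is asymptotic to `log n`. -/
theorem tendsto_centering_div (m : ℕ) {ξ : ℕ → ℝ} {x : ℝ} (hξ : Tendsto ξ atTop (𝓝 x)) :
    Tendsto (fun n : ℕ => (Real.log n + centering m n + ξ n) / Real.log n) atTop (𝓝 1) := by
  have h1 := tendsto_log_div_self.comp tendsto_log_natCast
  have h2 : Tendsto (fun n : ℕ => (Real.log n)⁻¹) atTop (𝓝 0) :=
    tendsto_inv_atTop_zero.comp tendsto_log_natCast
  have h3 := ((h1.const_mul ((m : ℝ) - 1)).add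
    ((hξ.sub_const (Real.log ((m - 1).factorial : ℝ))).mul h2)).const_add 1
  simp only [mul_zero, add_zero] at h3
  refine h3.congr' ?_
  filter_upwards [tendsto_log_natCast.eventually_gt_atTop 0] with n hn
  simp only [centering, Function.comp_apply]
  field_simp
  ring

/-- The centering sequence makes the expected number of large blocks converge. -/
theorem tendsto_mul_gammaTail {m : ℕ} (hm : 1 ≤ m) {ξ : ℕ → ℝ} {x : ℝ}
    (hξ : Tendsto ξ atTop (𝓝 x)) :
    Tendsto (fun n : ℕ => (n : ℝ) * gammaTail m (Real.log n + centering m n + ξ n)) atTop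
      (𝓝 (Real.exp (-x))) := by
  have hz := tendsto_centering_div m hξ
  obtain ⟨M, rfl⟩ := Nat.exists_eq_add_of_le' hm
  set z : ℕ → ℝ := fun n => Real.log n + centering (M + 1) n + ξ n with hzdef
  have h2 : Tendsto (fun n : ℕ => (Real.log n)⁻¹) atTop (𝓝 0) :=
    tendsto_inv_atTop_zero.comp tendsto_log_natCast
  -- after division by `(log n) ^ M`, only the top term of the polynomial survives
  have hsum : Tendsto (fun n : ℕ => (∑ j ∈ Finset.range M, (z n / Real.log n) ^ j /
      (j.factorial : ℝ) * (Real.log n)⁻¹ ^ (M - j)) + (z n / Real.log n) ^ M / (M.factorial : ℝ))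
      atTop (𝓝 (1 / (M.factorial : ℝ))) := by
    have ha : Tendsto (fun n : ℕ => ∑ j ∈ Finset.range M, (z n / Real.log n) ^ j /
        (j.factorial : ℝ) * (Real.log n)⁻¹ ^ (M - j)) atTop (𝓝 0) := by
      rw [← Finset.sum_const_zero (s := Finset.range M)]
      refine tendsto_finsetSum _ fun j hj => ?_
      have := ((hz.pow j).div_const (j.factorial : ℝ)).mul (h2.pow (M - j))
      rwa [zero_pow (by have := Finset.mem_range.1 hj; omega), mul_zero] at this
    have hb := (hz.pow M).div_const (M.factorial : ℝ)
    simpa using ha.add hb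
  have hexp : Tendsto (fun n => Real.exp (-ξ n)) atTop (𝓝 (Real.exp (-x))) :=
    (Real.continuous_exp.tendsto _).comp hξ.neg
  have hlim := (hsum.const_mul (M.factorial : ℝ)).mul hexp
  have hfac : (M.factorial : ℝ) ≠ 0 := by positivity
  rw [mul_one_div_cancel hfac, one_mul] at hlim
  refine hlim.congr' ?_
  filter_upwards [tendsto_log_natCast.eventually_gt_atTop 0, eventually_gt_atTop 0] with n hL hn
  have hn' : (0 : ℝ) < n := by exact_mod_cast hn
  have hexpz : Real.exp (-z n) =
      (n : ℝ)⁻¹ * (Real.log n ^ M)⁻¹ * M.factorial * Real.exp (-ξ n) := by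
    have : -z n = -Real.log n + -(M * Real.log (Real.log n)) + Real.log (M.factorial : ℝ) +
        -ξ n := by
      simp only [hzdef, centering, Nat.add_sub_cancel]
      push_cast
      ring
    rw [this, Real.exp_add, Real.exp_add, Real.exp_add, Real.exp_neg, Real.exp_log hn',
      Real.exp_log (by positivity), Real.exp_neg (_ * _), Real.exp_nat_mul, Real.exp_log hL]
  have hpoly : ∑ j ∈ Finset.range (M + 1), z n ^ j / (j.factorial : ℝ) = Real.log n ^ M *
      ((∑ j ∈ Finset.range M, (z n / Real.log n) ^ j /
      (j.factorial : ℝ) * (Real.log n)⁻¹ ^ (M - j)) + (z n / Real.log n) ^ M / M.factorial) := by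
    rw [Finset.sum_range_succ, mul_add, Finset.mul_sum]
    congr 1
    · refine Finset.sum_congr rfl fun j hj => ?_
      have hjM : j ≤ M := (Finset.mem_range.1 hj).le
      obtain ⟨d, rfl⟩ := Nat.exists_eq_add_of_le hjM
      rw [Nat.add_sub_cancel_left, div_pow, inv_pow, pow_add]
      field_simp
    · rw [div_pow]
      field_simp
  change _ = (n : ℝ) * gammaTail (M + 1) (z n)
  rw [gammaTail, hexpz, hpoly]
  field_simp

theorem tendsto_one_sub_gammaTail_pow {m : ℕ} (hm : 1 ≤ m) {ξ : ℕ → ℝ} {x : ℝ}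
    (hξ : Tendsto ξ atTop (𝓝 x)) :
    Tendsto (fun n : ℕ => (1 - gammaTail m (Real.log n + centering m n + ξ n)) ^ n) atTop
      (𝓝 (gumbel x)) := by
  have h := (tendsto_mul_gammaTail hm hξ).neg
  simp only [← mul_neg] at h
  exact Real.tendsto_one_add_pow_exp_of_tendsto h

/-- The Chebyshev error term when the total of `m * n` exponential variables is allowed a relative
deviation of `(log n) ^ (-2)`. -/
theorem tendsto_chebyshev_error {m : ℕ} (hm : 1 ≤ m) :
    Tendsto (fun n : ℕ => (m : ℝ) * n / (m * n / Real.log n ^ 2) ^ 2) atTop (𝓝 0) := by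
  have hm' : (m : ℝ) ≠ 0 := by positivity
  have h := (Real.tendsto_pow_log_div_mul_add_atTop m 0 4 hm').comp
    (tendsto_natCast_atTop_atTop (R := ℝ))
  refine h.congr' ?_
  filter_upwards [tendsto_log_natCast.eventually_gt_atTop 0, eventually_gt_atTop 0] with n hL hn
  have hn' : (0 : ℝ) < n := by exact_mod_cast hn
  simp only [Function.comp_apply]
  field_simp
  simp

theorem IsIIDUniform.tendsto_gumbel (hU : IsIIDUniform P U) [IsProbabilityMeasure P] {m : ℕ}
    (hm : 1 ≤ m) (x : ℝ) :
    Tendsto (fun n : ℕ => P.real {ω | maxNonoverlapping m n (fun i => U i ω) * ((m : ℝ) * n)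
      - Real.log n - centering m n < x}) atTop (𝓝 (gumbel x)) := by
  have hm' : (0 : ℝ) < m := by exact_mod_cast hm
  set a : ℕ → ℝ := fun n => Real.log n + centering m n + x with ha
  set δ : ℕ → ℝ := fun n => (m : ℝ) * n / (m * n / Real.log n ^ 2) ^ 2 with hδ
  have hδ0 : Tendsto δ atTop (𝓝 0) := tendsto_chebyshev_error hm
  have haL : Tendsto (fun n => a n / Real.log n) atTop (𝓝 1) :=
    tendsto_centering_div m tendsto_const_nhds
  have haL2 : Tendsto (fun n => a n / Real.log n ^ 2) atTop (𝓝 0) := by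
    have := haL.mul (tendsto_inv_atTop_zero.comp tendsto_log_natCast)
    rw [mul_zero] at this
    refine this.congr fun n => ?_
    simp only [Function.comp_apply]
    ring
  have hup : Tendsto (fun n => x + a n / Real.log n ^ 2) atTop (𝓝 x) := by
    simpa using haL2.const_add x
  have hlo : Tendsto (fun n => x - a n / Real.log n ^ 2) atTop (𝓝 x) := by
    simpa using haL2.const_sub x
  have hup' := (tendsto_one_sub_gammaTail_pow hm hup).add hδ0
  have hlo' := (tendsto_one_sub_gammaTail_pow hm hlo).sub hδ0
  rw [add_zero] at hup'
  rw [sub_zero] at hlo'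
  have hmain : ∀ᶠ n : ℕ in atTop,
      (1 - gammaTail m (Real.log n + centering m n + (x - a n / Real.log n ^ 2))) ^ n - δ n ≤
        P.real {ω | maxNonoverlapping m n (fun i => U i ω) * ((m : ℝ) * n)
          - Real.log n - centering m n < x} ∧
      P.real {ω | maxNonoverlapping m n (fun i => U i ω) * ((m : ℝ) * n)
          - Real.log n - centering m n < x} ≤
        (1 - gammaTail m (Real.log n + centering m n + (x + a n / Real.log n ^ 2))) ^ n + δ n := by
    filter_upwards [tendsto_log_natCast.eventually_gt_atTop 1, eventually_gt_atTop 0,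
      haL.eventually_const_lt zero_lt_one] with n hL hn haLn
    have hL0 : 0 < Real.log n := by linarith
    have hn' : (0 : ℝ) < n := by exact_mod_cast hn
    have hk : (0 : ℝ) < m * n := by positivity
    have han : 0 < a n := by
      have := mul_pos haLn hL0
      rwa [div_mul_cancel₀ _ hL0.ne'] at this
    have ht : 0 < a n / (m * n) := by positivity
    have hc : 0 < (m : ℝ) * n / Real.log n ^ 2 := by positivity
    have hck : (m : ℝ) * n / Real.log n ^ 2 < m * n := by
      refine div_lt_self hk ?_
      nlinarith
    have hset : {ω | maxNonoverlapping m n (fun i => U i ω) * ((m : ℝ) * n)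
        - Real.log n - centering m n < x} =
        {ω | maxNonoverlapping m n (fun i => U i ω) < a n / (m * n)} := by
      ext ω
      simp only [mem_ofPred_eq]
      rw [lt_div_iff₀ hk]
      simp only [ha]
      constructor <;> intro h <;> linarith
    rw [hset]
    have hA := hU.measureReal_maxNonoverlapping_lt hm hn ht hc hck.le
    have hB := hU.measureReal_le_maxNonoverlapping hm hn ht hc hck
    have hcov : 1 ≤ P.real {ω | maxNonoverlapping m n (fun i => U i ω) < a n / (m * n)} +
        P.real {ω | a n / (m * n) ≤ maxNonoverlapping m n (fun i => U i ω)} := by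
      rw [← probReal_univ (μ := P)]
      refine le_trans (measureReal_mono fun ω _ => ?_) (measureReal_union_le _ _)
      exact lt_or_ge (maxNonoverlapping m n fun i => U i ω) (a n / (m * n))
    have e1 : a n / (m * n) * (m * n + m * n / Real.log n ^ 2) =
        Real.log n + centering m n + (x + a n / Real.log n ^ 2) := by
      have : a n / (m * n) * (m * n + m * n / Real.log n ^ 2) = a n + a n / Real.log n ^ 2 := by
        field_simp
      rw [this]; simp only [ha]; ring
    have e2 : a n / (m * n) * (m * n - m * n / Real.log n ^ 2) =
        Real.log n + centering m n + (x - a n / Real.log n ^ 2) := by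
      have : a n / (m * n) * (m * n - m * n / Real.log n ^ 2) = a n - a n / Real.log n ^ 2 := by
        field_simp
      rw [this]; simp only [ha]; ring
    rw [e1] at hA
    rw [e2] at hB
    have hδn : 0 ≤ δ n := by simp only [hδ]; positivity
    change _ * (1 - δ n) ≤ _ at hA
    change _ * (1 - δ n) ≤ _ at hB
    have hF1 : P.real {ω | maxNonoverlapping m n (fun i => U i ω) < a n / (m * n)} ≤ 1 :=
      measureReal_le_one
    have hF2 : P.real {ω | a n / (m * n) ≤ maxNonoverlapping m n (fun i => U i ω)} ≤ 1 :=
      measureReal_le_one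
    have p1 := mul_le_mul_of_nonneg_right hF1 hδn
    have p2 := mul_le_mul_of_nonneg_right hF2 hδn
    constructor <;> linarith
  exact tendsto_of_tendsto_of_tendsto_of_le_of_le' hlo' hup' (hmain.mono fun _ h => h.1)
    (hmain.mono fun _ h => h.2)

/-! ### The almost sure lower bound -/

/-- Borel–Cantelli, for real-valued probabilities bounded from some index on. -/
theorem ae_eventually_notMem_of_measureReal_le [IsProbabilityMeasure P] {s : ℕ → Set Ω}
    {b : ℕ → ℝ} (hb : Summable b) (h : ∀ᶠ n in atTop, P.real (s n) ≤ b n) :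
    ∀ᵐ ω ∂P, ∀ᶠ n in atTop, ω ∉ s n := by
  have hs : Summable fun n => P.real (s n) := by
    refine Summable.of_norm_bounded_eventually_nat hb ?_
    filter_upwards [h] with n hn
    rwa [Real.norm_of_nonneg measureReal_nonneg]
  refine ae_eventually_notMem ?_
  have : ∀ n, P (s n) = ENNReal.ofReal (P.real (s n)) := fun n => by
    rw [ofReal_measureReal]
  simp only [this]
  exact hs.tsum_ofReal_ne_top

theorem gammaTail_le_one {m : ℕ} (hm : 1 ≤ m) {y : ℝ} (hy : 0 < y) : gammaTail m y ≤ 1 := by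
  rw [← expPi_real_le_sum hm hy]
  exact measureReal_le_one

theorem gammaTail_anti {m : ℕ} (hm : 1 ≤ m) {y z : ℝ} (hy : 0 < y) (hyz : y ≤ z) :
    gammaTail m z ≤ gammaTail m y := by
  rw [← expPi_real_le_sum hm hy, ← expPi_real_le_sum hm (hy.trans_le hyz)]
  exact measureReal_mono fun x hx => hyz.trans hx

theorem exp_neg_le_gammaTail {m : ℕ} (hm : 1 ≤ m) {y : ℝ} (hy : 0 ≤ y) :
    Real.exp (-y) ≤ gammaTail m y := by
  unfold gammaTail
  refine le_mul_of_one_le_right (Real.exp_pos _).le ?_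
  have := Finset.single_le_sum (f := fun j : ℕ => y ^ j / (j.factorial : ℝ))
    (fun j _ => by positivity) (Finset.mem_range.2 hm : 0 ∈ Finset.range m)
  simpa using this

/-- The maximal block is almost surely not much smaller than `log n / (m n)`: the probability of the
opposite is at most `2 * exp (-n ^ (ε / 2))`. -/
theorem IsIIDUniform.ae_eventually_lower (hU : IsIIDUniform P U) [IsProbabilityMeasure P] {m : ℕ}
    (hm : 1 ≤ m) {ε : ℝ} (hε : 0 < ε) (hε1 : ε < 1) :
    ∀ᵐ ω ∂P, ∀ᶠ n : ℕ in atTop,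
      (1 - ε) * Real.log n / (m * n) ≤ maxNonoverlapping m n (fun i => U i ω) := by
  have hm' : (0 : ℝ) < m := by exact_mod_cast hm
  have hsum : Summable fun n : ℕ => 2 * ((n : ℝ) ^ 2)⁻¹ :=
    (Real.summable_nat_pow_inv.2 one_lt_two).mul_left 2
  have key := ae_eventually_notMem_of_measureReal_le (P := P) (s := fun n : ℕ =>
    {ω | maxNonoverlapping m n (fun i => U i ω) < (1 - ε) * Real.log n / (m * n)}) hsum ?_
  · filter_upwards [key] with ω hω
    filter_upwards [hω] with n hn
    exact not_lt.1 hn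
  -- `2 * log n ≤ n ^ (ε / 2)` makes the exponential bound smaller than `2 * n ^ (-2)`
  have hexp : ∀ᶠ n : ℕ in atTop, 2 * Real.log n ≤ Real.exp (ε / 2 * Real.log n) := by
    have h1 : Tendsto (fun L : ℝ => Real.exp (ε / 2 * L) / L ^ 1) atTop atTop :=
      tendsto_exp_mul_div_rpow_atTop 1 (ε / 2) (by positivity) |>.congr fun L => by simp
    filter_upwards [(h1.comp tendsto_log_natCast).eventually_ge_atTop 2,
      tendsto_log_natCast.eventually_gt_atTop 0] with n hn hL
    simpa [le_div_iff₀ hL] using hn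
  filter_upwards [tendsto_log_natCast.eventually_gt_atTop 1, eventually_gt_atTop 0, hexp,
    tendsto_log_natCast.eventually_gt_atTop (2 / ε),
    (tendsto_chebyshev_error hm).eventually_lt_const (by norm_num : (0 : ℝ) < 1 / 2)]
    with n hL hn hexpn hLε hδ
  have hL0 : 0 < Real.log n := by linarith
  have hn' : (0 : ℝ) < n := by exact_mod_cast hn
  have hk : (0 : ℝ) < m * n := by positivity
  have hε' : 0 < 1 - ε := by linarith
  have ht : 0 < (1 - ε) * Real.log n / (m * n) := by positivity
  have hc : 0 < (m : ℝ) * n / Real.log n ^ 2 := by positivity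
  have hck : (m : ℝ) * n / Real.log n ^ 2 ≤ m * n := by
    refine div_le_self hk.le ?_
    nlinarith
  have hA := hU.measureReal_maxNonoverlapping_lt hm hn ht hc hck
  set y := (1 - ε) * Real.log n / (m * n) * (m * n + m * n / Real.log n ^ 2) with hy
  have hy_eq : y = (1 - ε) * Real.log n + (1 - ε) / Real.log n := by
    rw [hy]; field_simp
  have hy0 : 0 < y := by rw [hy]; positivity
  have hyle : y ≤ (1 - ε / 2) * Real.log n := by
    rw [hy_eq]
    have h1 : (1 - ε) / Real.log n ≤ 1 := by
      rw [div_le_one hL0]; linarith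
    have h2 : 2 < Real.log n * ε := (div_lt_iff₀ hε).1 hLε
    linarith
  have hg := exp_neg_le_gammaTail hm hy0.le
  have hg1 := gammaTail_le_one hm hy0
  have hgn : 2 * Real.log n ≤ n * gammaTail m y := by
    refine hexpn.trans ?_
    calc Real.exp (ε / 2 * Real.log n) =
        n * Real.exp (-((1 - ε / 2) * Real.log n)) := by
          nth_rewrite 2 [← Real.exp_log hn']
          rw [← Real.exp_add]; congr 1; ring
      _ ≤ n * Real.exp (-y) := by gcongr
      _ ≤ _ := by gcongr
  have hpow : (1 - gammaTail m y) ^ n ≤ ((n : ℝ) ^ 2)⁻¹ := by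
    calc (1 - gammaTail m y) ^ n ≤ Real.exp (-gammaTail m y) ^ n := by
          refine pow_le_pow_left₀ (by linarith) ?_ _
          have := Real.add_one_le_exp (-gammaTail m y)
          linarith
      _ = Real.exp (-(n * gammaTail m y)) := by rw [← Real.exp_nat_mul]; congr 1; ring
      _ ≤ Real.exp (-(2 * Real.log n)) := by gcongr
      _ = _ := by
        rw [Real.exp_neg]; congr 1
        have := Real.exp_nat_mul (Real.log n) 2
        rw [Real.exp_log hn'] at this
        exact_mod_cast this
  have hnn : 0 ≤ P.real {ω | maxNonoverlapping m n (fun i => U i ω) <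
    (1 - ε) * Real.log n / (m * n)} := measureReal_nonneg
  have := mul_le_mul_of_nonneg_left (show (1 : ℝ) / 2 ≤ 1 - m * n / (m * n / Real.log n ^ 2) ^ 2 by
    linarith) hnn
  linarith

/-! ### The almost sure upper bound -/

/-- The number of blocks at the `j`-th checkpoint, about `exp √j`. -/
noncomputable def checkpoint (j : ℕ) : ℕ := ⌊Real.exp √j⌋₊

/-- The interval length used at the `j`-th checkpoint. The coefficient `m + 4` of the logarithm is
large enough for the union bound over about `exp √j` windows to be of order `j ^ (-2)`. -/
noncomputable def checkpointThreshold (m j : ℕ) : ℝ :=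
  (√j + (m + 4) * Real.log √j) / (m * Real.exp √j)

/-- Consecutive checkpoints are so close that the threshold of the checkpoint preceding `n` is still
of the right order at `n`. -/
theorem eventually_checkpointThreshold_le {m : ℕ} (hm : 1 ≤ m) :
    ∀ᶠ n : ℕ in atTop, checkpoint ⌊Real.log n ^ 2⌋₊ ≤ n ∧
      checkpointThreshold m ⌊Real.log n ^ 2⌋₊ ≤
        Real.log n / (m * n) + (3 * m + 13) * (Real.log (Real.log n) / n) := by
  have hm' : (1 : ℝ) ≤ m := by exact_mod_cast hm
  have hll : Tendsto (fun n : ℕ => Real.log (Real.log n)) atTop atTop :=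
    Real.tendsto_log_atTop.comp tendsto_log_natCast
  filter_upwards [tendsto_log_natCast.eventually_gt_atTop 2, hll.eventually_ge_atTop 1,
    eventually_gt_atTop 0] with n hl hll1 hn
  have hn' : (0 : ℝ) < n := by exact_mod_cast hn
  set ℓ := Real.log n with hℓ
  have hnℓ : Real.exp ℓ = n := Real.exp_log hn'
  have hfl : (⌊ℓ ^ 2⌋₊ : ℝ) ≤ ℓ ^ 2 := Nat.floor_le (by positivity)
  have hfl2 : ℓ ^ 2 < ⌊ℓ ^ 2⌋₊ + 1 := Nat.lt_floor_add_one _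
  set L := √(⌊ℓ ^ 2⌋₊ : ℝ) with hL
  have hLsq : L ^ 2 = ⌊ℓ ^ 2⌋₊ := Real.sq_sqrt (Nat.cast_nonneg _)
  have hL0 : 0 ≤ L := Real.sqrt_nonneg _
  have hLl : L ≤ ℓ := by
    rw [hL]; exact Real.sqrt_le_iff.2 ⟨by linarith, hfl⟩
  rw [← hLsq] at hfl2
  have hL1 : 1 < L := by nlinarith
  have hd0 : 0 ≤ ℓ - L := by linarith
  -- `d = ℓ - L` satisfies `2 d L ≤ (ℓ + L) (ℓ - L) ≤ 1`
  have hd : 2 * (ℓ - L) * L ≤ 1 := by nlinarith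
  have hd1 : ℓ - L ≤ 1 / 2 := by nlinarith
  have hexpd : Real.exp (ℓ - L) ≤ 1 + 2 * (ℓ - L) := by
    have h := Real.abs_exp_sub_one_le (x := ℓ - L) (by rw [abs_of_nonneg hd0]; linarith)
    rw [abs_of_nonneg hd0] at h
    linarith [(abs_le.1 h).2]
  have hexpL : (Real.exp L)⁻¹ = Real.exp (ℓ - L) / n := by
    rw [← hnℓ, ← Real.exp_neg, ← Real.exp_sub]; congr 1; ring
  constructor
  · have : Real.exp L ≤ n := by rw [← hnℓ]; exact Real.exp_le_exp.2 hLl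
    exact Nat.floor_le_of_le this
  · change (L + (m + 4) * Real.log L) / (m * Real.exp L) ≤ _
    have hlogL : Real.log L ≤ Real.log ℓ := Real.log_le_log (by linarith) hLl
    have hlogL0 : 0 ≤ Real.log L := Real.log_nonneg hL1.le
    have hE : Real.exp (ℓ - L) ≤ 2 := by linarith
    have hE0 : 0 < Real.exp (ℓ - L) := Real.exp_pos _
    have e1 : (L + (m + 4) * Real.log L) / (m * Real.exp L) =
        (L + (m + 4) * Real.log L) * Real.exp (ℓ - L) / (m * n) := by
      rw [div_eq_mul_inv, mul_inv, hexpL]; field_simp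
    have e2 : Real.log n / (m * n) + (3 * m + 13) * (Real.log (Real.log n) / n) =
        (ℓ + m * ((3 * m + 13) * Real.log ℓ)) / (m * n) := by
      rw [← hℓ]; field_simp
    rw [e1, e2]
    refine div_le_div_of_nonneg_right ?_ (by positivity)
    have h1 : L * Real.exp (ℓ - L) ≤ ℓ + 1 := by
      calc L * Real.exp (ℓ - L) ≤ L * (1 + 2 * (ℓ - L)) := by gcongr
        _ ≤ ℓ + 1 := by linarith
    have h2 : (m + 4) * Real.log L * Real.exp (ℓ - L) ≤ (m + 4) * Real.log ℓ * 2 := by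
      gcongr
    have hlog : 0 < Real.log ℓ := by linarith
    have h3 : (3 * m + 13) * Real.log ℓ ≤ m * ((3 * m + 13) * Real.log ℓ) :=
      le_mul_of_one_le_left (by positivity) hm'
    have h4 : 0 ≤ (m : ℝ) * Real.log ℓ := by positivity
    nlinarith

/-- With `L = √j`, the union bound over about `exp L` windows at the `j`-th threshold leaves
`L ^ (-4) = j ^ (-2)`, which is summable. The summand `-1` absorbs the deviation of the total from
its mean and the rounding in `checkpoint`. -/
theorem eventually_mul_gammaTail_le {m : ℕ} (hm : 1 ≤ m) :
    ∀ᶠ L : ℝ in atTop, 0 < L + (m + 4) * Real.log L - 1 ∧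
      Real.exp L * gammaTail m (L + (m + 4) * Real.log L - 1) ≤ 3 * (L ^ 4)⁻¹ := by
  obtain ⟨M, rfl⟩ := Nat.exists_eq_add_of_le' hm
  have hlog : ∀ᶠ L : ℝ in atTop, ((M + 1 : ℕ) + 4) * (Real.log L / L) < 1 := by
    have := tendsto_log_div_self.const_mul (((M + 1 : ℕ) : ℝ) + 4)
    rw [mul_zero] at this
    exact this.eventually_lt_const one_pos
  filter_upwards [hlog, eventually_gt_atTop 2, eventually_ge_atTop (((M : ℝ) + 1) * 2 ^ M)]
    with L h1 h2 h3
  have hL0 : 0 < L := by linarith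
  have hlogpos : 0 < Real.log L := Real.log_pos (by linarith)
  set y := L + ((M + 1 : ℕ) + 4) * Real.log L - 1 with hy
  have hyL : y ≤ 2 * L := by
    have : ((M + 1 : ℕ) + 4) * Real.log L < L := by
      rw [← mul_div_assoc, div_lt_one hL0] at h1
      exact h1
    linarith
  have hprod : 0 < (((M + 1 : ℕ) : ℝ) + 4) * Real.log L := by positivity
  have hy1 : 1 < y := by linarith
  refine ⟨by linarith, ?_⟩
  have hpoly : ∑ j ∈ Finset.range (M + 1), y ^ j / (j.factorial : ℝ) ≤ L ^ (M + 1) := by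
    calc ∑ j ∈ Finset.range (M + 1), y ^ j / (j.factorial : ℝ)
        ≤ ∑ j ∈ Finset.range (M + 1), (2 * L) ^ M := by
          refine Finset.sum_le_sum fun j hj => ?_
          calc y ^ j / (j.factorial : ℝ) ≤ y ^ j :=
                div_le_self (by positivity) (by exact_mod_cast j.factorial_pos)
            _ ≤ (2 * L) ^ j := by gcongr
            _ ≤ (2 * L) ^ M := pow_le_pow_right₀ (by linarith)
                (by have := Finset.mem_range.1 hj; omega)
      _ = ((M + 1) * 2 ^ M) * L ^ M := by
          rw [Finset.sum_const, Finset.card_range, nsmul_eq_mul, mul_pow]; push_cast; ring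
      _ ≤ L * L ^ M := by gcongr
      _ = L ^ (M + 1) := by ring
  have hexp : Real.exp (-y) = Real.exp 1 * (Real.exp L)⁻¹ * (L ^ (M + 1 + 4))⁻¹ := by
    have : -y = 1 + -L + -((M + 1 + 4 : ℕ) * Real.log L) := by rw [hy]; push_cast; ring
    rw [this, Real.exp_add, Real.exp_add, Real.exp_neg, Real.exp_neg, Real.exp_nat_mul,
      Real.exp_log hL0]
  calc Real.exp L * gammaTail (M + 1) y ≤ Real.exp L * (Real.exp (-y) * L ^ (M + 1)) := by
        unfold gammaTail; gcongr
    _ = Real.exp 1 * (L ^ 4)⁻¹ := by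
        rw [hexp, pow_add]
        have := (Real.exp_pos L).ne'
        field_simp
    _ ≤ _ := by
        have := Real.exp_one_lt_d9
        gcongr
        linarith

/-- A relative error of at most `1 / L ^ 2`, incurred twice, costs at most `1` in an argument
`A ≤ 2 * L`. -/
theorem sub_one_le_threshold_mul {m L A E κ : ℝ} (hm : 1 ≤ m) (hL : 4 < L) (hA0 : 0 < A)
    (hA : A ≤ 2 * L) (hE : L ^ 2 ≤ E) (hκ : m * (E - 1) ≤ κ) :
    A - 1 ≤ A / (m * E) * (κ - κ / L ^ 2) := by
  have hL2 : 0 < L ^ 2 := by positivity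
  have hE0 : 0 < E := hL2.trans_le hE
  have hm0 : 0 < m := by linarith
  have h1 : 1 - 1 / L ^ 2 ≤ κ / (m * E) := by
    rw [le_div_iff₀ (by positivity)]
    refine le_trans ?_ hκ
    have h2 : 1 ≤ 1 / L ^ 2 * E := by
      rw [one_div, inv_mul_eq_div, le_div_iff₀ hL2]; linarith
    have h3 : (1 - 1 / L ^ 2) * (m * E) = m * (E - 1 / L ^ 2 * E) := by ring
    rw [h3]
    exact mul_le_mul_of_nonneg_left (by linarith) hm0.le
  have h2 : A / (m * E) * (κ - κ / L ^ 2) = A * (κ / (m * E)) * (1 - 1 / L ^ 2) := by ring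
  have h3 : A * (1 / L ^ 2) ≤ 1 / 2 := by
    rw [mul_one_div, div_le_iff₀ hL2]
    nlinarith
  have h4 : 0 ≤ A * (1 / L ^ 2) * (1 / L ^ 2) := by positivity
  have h5 : 0 ≤ 1 - 1 / L ^ 2 := by
    rw [sub_nonneg, div_le_one hL2]; nlinarith
  have h6 : A * (1 - 1 / L ^ 2) * (1 - 1 / L ^ 2) =
      A - 2 * (A * (1 / L ^ 2)) + A * (1 / L ^ 2) * (1 / L ^ 2) := by ring
  rw [h2]
  calc A - 1 ≤ A * (1 - 1 / L ^ 2) * (1 - 1 / L ^ 2) := by rw [h6]; linarith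
    _ ≤ _ := mul_le_mul_of_nonneg_right (mul_le_mul_of_nonneg_left h1 hA0.le) h5

theorem tendsto_sqrt_natCast : Tendsto (fun j : ℕ => √(j : ℝ)) atTop atTop :=
  Real.tendsto_sqrt_atTop.comp tendsto_natCast_atTop_atTop

theorem IsIIDUniform.ae_mem_Icc (hU : IsIIDUniform P U) [IsProbabilityMeasure P] :
    ∀ᵐ ω ∂P, ∀ j, U j ω ∈ Icc (0 : ℝ) 1 := by
  refine ae_all_iff.2 fun j => ?_
  have h : ∀ᵐ x ∂(P.map (U j)), x ∈ Icc (0 : ℝ) 1 := by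
    rw [hU.uniform j, ProbabilityTheory.cond]
    exact Measure.ae_smul_measure (ae_restrict_mem measurableSet_Icc) _
  exact ae_of_ae_map (hU.measurable j).aemeasurable h

/-- Almost surely, from some checkpoint on, every interval of the threshold length contains at least
`m` points. -/
theorem IsIIDUniform.ae_eventually_not_hasSparseInterval (hU : IsIIDUniform P U)
    [IsProbabilityMeasure P] {m : ℕ} (hm : 1 ≤ m) :
    ∀ᵐ ω ∂P, ∀ᶠ j : ℕ in atTop, ¬ HasSparseInterval m (m * checkpoint j - 1)
      (checkpointThreshold m j) fun i => U i ω := by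
  have hm' : (1 : ℝ) ≤ m := by exact_mod_cast hm
  have hsum : Summable fun j : ℕ => (6 * m : ℝ) * ((j : ℝ) ^ 2)⁻¹ :=
    (Real.summable_nat_pow_inv.2 one_lt_two).mul_left _
  have key := ae_eventually_notMem_of_measureReal_le (P := P) (s := fun j : ℕ =>
    {ω | ∃ i, i + m ≤ m * checkpoint j - 1 + 1 ∧ checkpointThreshold m j ≤
      withEndpoints (sorted fun l : Fin (m * checkpoint j - 1) => U l ω) (i + m) -
      withEndpoints (sorted fun l : Fin (m * checkpoint j - 1) => U l ω) i}) hsum ?_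
  · filter_upwards [key, hU.ae_mem_Icc] with ω hω hmem
    filter_upwards [hω, eventually_ge_atTop 1] with j hj hj1 hs
    have hc : 1 ≤ checkpoint j := Nat.le_floor (by
      rw [Nat.cast_one]; exact Real.one_le_exp (Real.sqrt_nonneg _))
    have hmc : m * 1 ≤ m * checkpoint j := Nat.mul_le_mul_left _ hc
    exact hj (hs.exists_le_sub (by omega) hmem)
  have hE : ∀ᶠ L : ℝ in atTop, 4 * L ^ 4 ≤ Real.exp L := by
    filter_upwards [(Real.tendsto_exp_div_pow_atTop 4).eventually_ge_atTop 4,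
      eventually_gt_atTop 0] with L h h0
    exact (le_div_iff₀ (by positivity)).1 h
  have hlog : ∀ᶠ L : ℝ in atTop, ((m : ℝ) + 4) * (Real.log L / L) < 1 := by
    have := tendsto_log_div_self.const_mul ((m : ℝ) + 4)
    rw [mul_zero] at this
    exact this.eventually_lt_const one_pos
  filter_upwards [tendsto_sqrt_natCast.eventually hE, tendsto_sqrt_natCast.eventually hlog,
    tendsto_sqrt_natCast.eventually (eventually_mul_gammaTail_le hm),
    tendsto_sqrt_natCast.eventually_gt_atTop 4] with j hE hlog hg hL
  have hLsq : √(j : ℝ) ^ 2 = j := Real.sq_sqrt (Nat.cast_nonneg _)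
  have hj4 : ((j : ℝ) ^ 2)⁻¹ = (√(j : ℝ) ^ 4)⁻¹ := by
    rw [show √(j : ℝ) ^ 4 = (√(j : ℝ) ^ 2) ^ 2 by ring, hLsq]
  rw [hj4]
  simp only [checkpointThreshold]
  set L := √(j : ℝ) with hLdef
  have hL0 : 0 < L := by linarith
  have hlogpos : 0 < Real.log L := Real.log_pos (by linarith)
  have hflo : Real.exp L - 1 < checkpoint j := by
    have := Nat.lt_floor_add_one (Real.exp L)
    simp only [checkpoint, ← hLdef]; linarith
  have hfle : (checkpoint j : ℝ) ≤ Real.exp L := Nat.floor_le (Real.exp_pos _).le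
  have hL4 : 1 ≤ L ^ 4 := one_le_pow₀ (by linarith)
  have hcp : 1 ≤ checkpoint j := Nat.le_floor (by
    rw [Nat.cast_one]; exact Real.one_le_exp (Real.sqrt_nonneg _))
  obtain ⟨N, hN⟩ := Nat.exists_eq_add_of_le' (Nat.mul_pos hm hcp : 1 ≤ m * checkpoint j)
  have hNR : (m : ℝ) * checkpoint j = N + 1 := by exact_mod_cast hN
  rw [show m * checkpoint j - 1 = N by omega]
  have hk : (0 : ℝ) < N + 1 := by positivity
  have hExp := Real.exp_pos L
  have ht : 0 < (L + (m + 4) * Real.log L) / (m * Real.exp L) := by positivity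
  have hc : 0 < ((N : ℝ) + 1) / L ^ 2 := by positivity
  have hck : ((N : ℝ) + 1) / L ^ 2 < N + 1 := div_lt_self hk (by nlinarith)
  have hO := hU.measureReal_exists_le_withEndpoints_sub (N := N) hm ht hc hck
  have hNup : (N : ℝ) + 1 ≤ m * Real.exp L := by rw [← hNR]; gcongr
  have hNlo : (m : ℝ) * (Real.exp L - 1) ≤ N + 1 := by rw [← hNR]; gcongr
  -- the Chebyshev error is at most one half
  have hδ : ((N : ℝ) + 1) / (((N : ℝ) + 1) / L ^ 2) ^ 2 ≤ 1 / 2 := by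
    have e : ((N : ℝ) + 1) / (((N : ℝ) + 1) / L ^ 2) ^ 2 = L ^ 4 / (N + 1) := by field_simp
    rw [e, div_le_iff₀ hk]
    have : Real.exp L - 1 ≤ m * (Real.exp L - 1) := le_mul_of_one_le_left (by linarith) hm'
    linarith
  -- the argument of the tail loses at most one
  have hy : L + (m + 4) * Real.log L - 1 ≤
      (L + (m + 4) * Real.log L) / (m * Real.exp L) * (N + 1 - (N + 1) / L ^ 2) := by
    rw [← mul_div_assoc, div_lt_one hL0] at hlog
    have hL24 : L ^ 2 ≤ L ^ 4 := pow_le_pow_right₀ (by linarith) (by norm_num)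
    exact sub_one_le_threshold_mul hm' hL (by positivity) (by linarith) (by linarith) hNlo
  have hT : ((N : ℝ) + 1) * gammaTail m ((L + (m + 4) * Real.log L) / (m * Real.exp L) *
      (N + 1 - (N + 1) / L ^ 2)) ≤ 3 * m * (L ^ 4)⁻¹ := by
    calc _ ≤ (m * Real.exp L) * gammaTail m (L + (m + 4) * Real.log L - 1) :=
          mul_le_mul hNup (gammaTail_anti hm hg.1 hy)
            (gammaTail_nonneg m (hg.1.le.trans hy)) (by positivity)
      _ = m * (Real.exp L * gammaTail m (L + (m + 4) * Real.log L - 1)) := by ring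
      _ ≤ m * (3 * (L ^ 4)⁻¹) := mul_le_mul_of_nonneg_left hg.2 (by linarith)
      _ = _ := by ring
  have hfin := mul_le_mul_of_nonneg_left
    (show (1 : ℝ) / 2 ≤ 1 - ((N : ℝ) + 1) / (((N : ℝ) + 1) / L ^ 2) ^ 2 by linarith)
    (measureReal_nonneg (μ := P) (s := {ω | ∃ i, i + m ≤ N + 1 ∧
      (L + (m + 4) * Real.log L) / (m * Real.exp L) ≤
        withEndpoints (sorted fun l : Fin N => U l ω) (i + m) -
        withEndpoints (sorted fun l : Fin N => U l ω) i}))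
  linarith

/-- A large block at `n` is a sparse interval for the points of the last checkpoint not
exceeding `n`. -/
theorem IsIIDUniform.ae_eventually_upper (hU : IsIIDUniform P U) [IsProbabilityMeasure P] {m : ℕ}
    (hm : 1 ≤ m) :
    ∀ᵐ ω ∂P, ∀ᶠ n : ℕ in atTop, maxNonoverlapping m n (fun i => U i ω) ≤
      Real.log n / ((m : ℝ) * n) + (3 * m + 13) * (Real.log (Real.log n) / n) := by
  have hj : Tendsto (fun n : ℕ => ⌊Real.log n ^ 2⌋₊) atTop atTop :=
    tendsto_nat_floor_atTop.comp ((tendsto_pow_atTop two_ne_zero).comp tendsto_log_natCast)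
  filter_upwards [hU.ae_eventually_not_hasSparseInterval hm, hU.ae_mem_Icc] with ω hω hmem
  filter_upwards [hj.eventually hω, eventually_checkpointThreshold_le hm, eventually_ge_atTop 1]
    with n hn hthr hn1
  refine le_trans (le_of_lt ?_) hthr.2
  rw [maxNonoverlapping_lt_iff hn1]
  intro i hi
  by_contra! hle
  refine hn ((hasSparseInterval_of_le_sub hm hmem hle).anti ?_)
  have := Nat.mul_le_mul_left m hthr.1
  omega

/-! ### The almost sure limit -/

theorem IsIIDUniform.ae_tendsto (hU : IsIIDUniform P U) [IsProbabilityMeasure P] {m : ℕ}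
    (hm : 1 ≤ m) :
    ∀ᵐ ω ∂P, Tendsto (fun n : ℕ => maxNonoverlapping m n (fun i => U i ω) * ((m : ℝ) * n) /
      Real.log n) atTop (𝓝 1) := by
  have hm' : (0 : ℝ) < m := by exact_mod_cast hm
  have hlow : ∀ᵐ ω ∂P, ∀ q : ℕ, ∀ᶠ n : ℕ in atTop,
      (1 - 1 / ((q : ℝ) + 2)) * Real.log n / (m * n) ≤ maxNonoverlapping m n (fun i => U i ω) :=
    ae_all_iff.2 fun q => hU.ae_eventually_lower hm (by positivity) (by
      rw [div_lt_one (by positivity)]; linarith [(Nat.cast_nonneg q : (0 : ℝ) ≤ q)])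
  filter_upwards [hlow, hU.ae_eventually_upper hm] with ω hlo hup
  refine tendsto_order.2 ⟨fun a ha => ?_, fun b hb => ?_⟩
  -- the lower bounds along `ε = 1 / (q + 2)` are simultaneously valid almost surely
  · obtain ⟨q, hq⟩ := exists_nat_one_div_lt (show (0 : ℝ) < 1 - a by linarith)
    filter_upwards [hlo q, tendsto_log_natCast.eventually_gt_atTop 0, eventually_gt_atTop 0]
      with n hn hL hn0
    have hn' : (0 : ℝ) < n := by exact_mod_cast hn0
    rw [div_le_iff₀ (by positivity)] at hn
    rw [lt_div_iff₀ hL]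
    refine lt_of_lt_of_le ?_ hn
    have : 1 / ((q : ℝ) + 2) < 1 / (q + 1) := one_div_lt_one_div_of_lt (by positivity) (by linarith)
    exact mul_lt_mul_of_pos_right (by linarith) hL
  · have hlim : Tendsto (fun n : ℕ => 1 + m * (3 * m + 13) * (Real.log (Real.log n) / Real.log n))
        atTop (𝓝 1) := by
      have := ((tendsto_log_div_self.comp tendsto_log_natCast).const_mul
        ((m : ℝ) * (3 * m + 13))).const_add 1
      simpa using this
    filter_upwards [hup, hlim.eventually_lt_const hb,
      tendsto_log_natCast.eventually_gt_atTop 0, eventually_gt_atTop 0] with n hn hbn hL hn0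
    have hn' : (0 : ℝ) < n := by exact_mod_cast hn0
    refine lt_of_le_of_lt ?_ hbn
    rw [div_le_iff₀ hL]
    calc _ ≤ (Real.log n / ((m : ℝ) * n) + (3 * m + 13) * (Real.log (Real.log n) / n)) *
          (m * n) := mul_le_mul_of_nonneg_right hn (by positivity)
      _ = _ := by field_simp

end UniformSpacings

theorem mainTheorem4 (m : ℕ) (hm : 1 ≤ m) :
    ∃ C : ℝ, ∀ (Ω : Type*) [MeasurableSpace Ω] (P : MeasureTheory.Measure Ω)
      [MeasureTheory.IsProbabilityMeasure P] (U : ℕ → Ω → ℝ),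
      UniformSpacings.IsIIDUniform P U →
        -- Gumbel limit law
        (∀ x : ℝ, Filter.Tendsto
          (fun n : ℕ => P.real {ω |
            UniformSpacings.maxNonoverlapping m n (fun i => U i ω) * ((m : ℝ) * n)
              - Real.log n - UniformSpacings.centering m n < x})
          Filter.atTop (nhds (UniformSpacings.gumbel x))) ∧
        -- almost sure upper bound
        (∀ᵐ ω ∂P, ∀ᶠ n : ℕ in Filter.atTop,
          UniformSpacings.maxNonoverlapping m n (fun i => U i ω) ≤
            Real.log n / ((m : ℝ) * n) + C * (Real.log (Real.log n) / n)) ∧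
        -- almost sure limit
        (∀ᵐ ω ∂P, Filter.Tendsto
          (fun n : ℕ =>
            UniformSpacings.maxNonoverlapping m n (fun i => U i ω) * ((m : ℝ) * n) / Real.log n)
          Filter.atTop (nhds 1)) :=
  ⟨3 * m + 13, fun _ _ _ _ _ hU =>
    ⟨hU.tendsto_gumbel hm, hU.ae_eventually_upper hm, hU.ae_tendsto hm⟩⟩
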